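/- Let $m\ge 1$, let $0=k_0<k_1<\dots<k_m<k_{m+1}=d$ be integers with $\gcd(k_1,\dots,k_m,d)=1$, and let $A=\begin{pmatrix}1&1&\cdots&1\\ k_0&k_1&\cdots&k_{m+1}\end{pmatrix}$. Index the coordinates of $\mathbb C^{m+2}$ by $k_0,\dots,k_{m+1}$. Put $$f(x;t)=\sum_{j=0}^{m+1}x_{k_j}t^{k_j},\qquad I(A)=A\cdot\mathbb N^{m+2}\subset\mathbb Z^2,\qquad \Sigma=\{x_0=0\}\cup\{x_d=0\}\cup\{\Delta(f)=0\}\subset\mathbb C^{m+2},$$ where $\Delta(f)$ is the discriminant of $f$ with respect to $t$. For $\alpha\in\mathbb Z^2$ let $\Phi(\alpha;x)=\sum_{u\in\mathbb N^{m+2},\,A u=\alpha}x^u/u!$, and for $u\in\mathbb N^{m+2}$ let $D_u=\partial^{|u|}/\partial x^u$. The $A$-hypergeometric system with exponent $\alpha=(\alpha_1,\alpha_2)$ is $$D_{v^+}\varphi=D_{v^-}\varphi\quad(v=v^+-v^-\in\mathbb Z^{m+2},\ Av=0),\qquad \sum_j x_{k_j}\frac{\partial\varphi}{\partial x_{k_j}}=\alpha_1\varphi,\qquad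 \sum_j k_j\,x_{k_j}\frac{\partial\varphi}{\partial x_{k_j}}=\alpha_2\varphi ,$$ where $v^{\pm}$ are the positive and negative parts of $v$. Let $U\subset\mathbb C^{m+2}\setminus\Sigma$ be a simply connected open set and let $\rho_1,\dots,\rho_d$ be holomorphic functions on $U$ such that $\rho_1(x),\dots,\rho_d(x)$ are the $d$ distinct roots of $f(x;t)$ for every $x\in U$. For $\alpha\in\mathbb Z^2\setminus I(A)$ with $\alpha_1\ge0$ put $$\psi_j(\alpha)=\sum_{\substack{0\le i\le d\alpha_1\\ i\ne\alpha_2}}\Phi((\alpha_1,i);x)\,\frac{\rho_j(x)^{\,i-\alpha_2}}{i-\alpha_2},$$ and for $\alpha\in\mathbb Z^2\setminus I(A)$ with $\alpha_1<0$ put $\psi_j(\alpha)=D_u\big(\psi_j(\alpha+Au)\big)$, where $u\in\mathbb N^{m+2}$ is any vector such that $\alpha+Au\notin I(A)$ has nonnegative first coordinate (such $u$ exist, and the assertions below hold whichever $u$ is used, the same for all $j$). Let $\Psi^A(\alpha)=\psi_1(\alpha)+\dots+\psi_d(\alpha)$. **Theorem 2.4.** For every $\alpha\in\mathbb Z^2\setminus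 I(A)$, the functions $\psi_1(\alpha),\dots,\psi_d(\alpha)$ are holomorphic solutions on $U$ of the $A$-hypergeometric system with exponent $\alpha$, and they span a complex linear space of dimension at least $d-1$. Moreover, they are linearly dependent over $\mathbb C$ if and only if $\Psi^A(\alpha)=0$ on $U$. -/

import Mathlib

namespace MonomialCurve

open Polynomial

noncomputable section

/-- The matrix `A` with first row `(1, 1, …, 1)` and second row `(k₀, k₁, …, k_{m+1})`.
For the monomial curves considered here `k₀ = 0 < k₁ < ⋯ < k_{m+1} = d`. -/
def curveMatrix {m : ℕ} (k : Fin (m + 2) → ℕ) : Matrix (Fin 2) (Fin (m + 2)) ℤ :=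
  Matrix.of ![fun _ => 1, fun j => (k j : ℤ)]

/-- The product `A · u ∈ ℤ²` for a multi-index `u`. -/
def deg {m : ℕ} (k : Fin (m + 2) → ℕ) (u : Fin (m + 2) → ℕ) : Fin 2 → ℤ :=
  (curveMatrix k).mulVec fun j => (u j : ℤ)

/-- The semigroup `I(A) = A · ℕ^{m+2}`. -/
def semigroupI {m : ℕ} (k : Fin (m + 2) → ℕ) : Set (Fin 2 → ℤ) :=
  Set.range (deg k)

theorem deg_zero_apply {m : ℕ} (k u : Fin (m + 2) → ℕ) : deg k u 0 = ∑ j, (u j : ℤ) := by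
  simp [deg, curveMatrix, Matrix.mulVec, dotProduct]

theorem deg_one_apply {m : ℕ} (k u : Fin (m + 2) → ℕ) :
    deg k u 1 = ∑ j, (k j : ℤ) * (u j : ℤ) := by
  simp [deg, curveMatrix, Matrix.mulVec, dotProduct]

/-- The finite set of all multi-indices `u` with `A · u = α` (see `mem_fiber`). -/
def fiber {m : ℕ} (k : Fin (m + 2) → ℕ) (α : Fin 2 → ℤ) : Finset (Fin (m + 2) → ℕ) :=
  (Finset.univ.piAntidiag (α 0).toNat).filter fun u => deg k u = α

theorem mem_fiber {m : ℕ} (k : Fin (m + 2) → ℕ) (α : Fin 2 → ℤ) (u : Fin (m + 2) → ℕ) :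
    u ∈ fiber k α ↔ deg k u = α := by
  simp only [fiber, Finset.mem_filter, Finset.mem_piAntidiag, and_iff_right_iff_imp]
  rintro rfl
  refine ⟨?_, fun i _ => Finset.mem_univ i⟩
  rw [deg_zero_apply, ← Nat.cast_sum, Int.toNat_natCast]

/-- The hypergeometric polynomial `Φ(α; x) = ∑_{A·u = α} x^u / u!`
(equal to `0` if `α ∉ I(A)`). -/
def hypPoly {m : ℕ} (k : Fin (m + 2) → ℕ) (α : Fin 2 → ℤ) (x : Fin (m + 2) → ℂ) : ℂ :=
  ∑ u ∈ fiber k α, ∏ j, x j ^ u j / ((u j).factorial : ℂ)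

/-- The polynomial `f(x; t) = ∑ⱼ xⱼ t^{kⱼ}` in the variable `t`. -/
def genPoly {m : ℕ} (k : Fin (m + 2) → ℕ) (x : Fin (m + 2) → ℂ) : ℂ[X] :=
  ∑ j, C (x j) * X ^ k j

/-- The singular locus `Σ = {x₀ = 0} ∪ {x_d = 0} ∪ {Δ(f) = 0}`. -/
def singularLocus {m : ℕ} (k : Fin (m + 2) → ℕ) : Set (Fin (m + 2) → ℂ) :=
  {x | x 0 = 0 ∨ x (Fin.last (m + 1)) = 0 ∨ (genPoly k x).discr = 0}

/-- The partial derivative `∂g/∂xⱼ`. -/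
def partialD {n : ℕ} (j : Fin n) (g : (Fin n → ℂ) → ℂ) : (Fin n → ℂ) → ℂ :=
  fun x => fderiv ℂ g x (Pi.single j 1)

/-- The operator `D_u = ∂^{|u|}/∂x^u`, as a composition of partial derivatives. -/
def iterD {n : ℕ} (u : Fin n → ℕ) (g : (Fin n → ℂ) → ℂ) : (Fin n → ℂ) → ℂ :=
  (List.finRange n).foldr (fun j h => (partialD j)^[u j] h) g

/-- `φ` is a holomorphic solution on `U` of the `A`-hypergeometric system with exponent `α`:
`D_{v⁺} φ = D_{v⁻} φ` for all integer vectors `v` with `A · v = 0`, and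
`∑ⱼ A_{ij} xⱼ ∂φ/∂xⱼ = αᵢ φ` for both rows `i`. -/
def IsHypergeometricOn {m : ℕ} (k : Fin (m + 2) → ℕ) (α : Fin 2 → ℤ)
    (U : Set (Fin (m + 2) → ℂ)) (φ : (Fin (m + 2) → ℂ) → ℂ) : Prop :=
  DifferentiableOn ℂ φ U ∧
  (∀ v : Fin (m + 2) → ℤ, (curveMatrix k).mulVec v = 0 → ∀ x ∈ U,
    iterD (fun j => (v j).toNat) φ x = iterD (fun j => (-v j).toNat) φ x) ∧
  (∀ i : Fin 2, ∀ x ∈ U,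
    ∑ j, (curveMatrix k i j : ℂ) * x j * partialD j φ x = (α i : ℂ) * φ x)

/-- For `α = (α₁, α₂) ∉ I(A)` with `α₁ ≥ 0` and a root `ρ` of `f(x; t)`, the function
`∑_{0 ≤ i ≤ d α₁, i ≠ α₂} Φ((α₁, i); x) ρ(x)^{i - α₂} / (i - α₂)`, where `d = k_{m+1}`.
(For general `α` there is an additional term `Φ(α; x) log ρ(x)`, which is identically zero
for `α ∉ I(A)`; only such `α` are used.) -/
def psiNonneg {m : ℕ} (k : Fin (m + 2) → ℕ) (ρ : (Fin (m + 2) → ℂ) → ℂ) (α : Fin 2 → ℤ)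
    (x : Fin (m + 2) → ℂ) : ℂ :=
  ∑ i ∈ (Finset.range (k (Fin.last (m + 1)) * (α 0).toNat + 1)).filter
      (fun i : ℕ => (i : ℤ) ≠ α 1),
    hypPoly k ![α 0, (i : ℤ)] x * (ρ x ^ ((i : ℤ) - α 1) / (((i : ℤ) - α 1 : ℤ) : ℂ))

/-- `u` may be used to define `ψ_ρ(α)`: the shifted exponent `α + A·u` has nonnegative first
coordinate and is not in `I(A)`. -/
def IsAdmissible {m : ℕ} (k : Fin (m + 2) → ℕ) (α : Fin 2 → ℤ) (u : Fin (m + 2) → ℕ) : Prop :=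
  0 ≤ (α + deg k u) 0 ∧ α + deg k u ∉ semigroupI k

/-- The function `ψ_ρ(α) = D_u (ψ_ρ(α + A·u))` for an admissible `u`. For `α₁ ≥ 0` one may take
`u = 0`, which gives `psiNonneg` (see `psi_zero`). -/
def psi {m : ℕ} (k : Fin (m + 2) → ℕ) (ρ : (Fin (m + 2) → ℂ) → ℂ) (α : Fin 2 → ℤ)
    (u : Fin (m + 2) → ℕ) : (Fin (m + 2) → ℂ) → ℂ :=
  iterD u (psiNonneg k ρ (α + deg k u))

theorem iterD_zero {n : ℕ} (g : (Fin n → ℂ) → ℂ) : iterD 0 g = g := by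
  unfold iterD
  induction List.finRange n with
  | nil => rfl
  | cons a l ih => simp

theorem psi_zero {m : ℕ} (k : Fin (m + 2) → ℕ) (ρ : (Fin (m + 2) → ℂ) → ℂ) (α : Fin 2 → ℤ) :
    psi k ρ α 0 = psiNonneg k ρ α := by
  have h : deg k 0 = 0 := by
    ext i
    simp [deg, Matrix.mulVec, dotProduct]
  rw [psi, iterD_zero, h, add_zero]

/-- Every exponent outside `I(A)` has an admissible shift. -/
theorem exists_isAdmissible {m : ℕ} (k : Fin (m + 2) → ℕ) (hk : StrictMono k) (h0 : k 0 = 0)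
    (α : Fin 2 → ℤ) (hα : α ∉ semigroupI k) : ∃ u, IsAdmissible k α u := by
  have hd : 0 < k (Fin.last (m + 1)) := h0 ▸ hk (Fin.last_pos)
  -- an exponent `(0, c)` with `c ≠ 0` is not in the semigroup
  have key : ∀ β : Fin 2 → ℤ, β 0 = 0 → β 1 ≠ 0 → β ∉ semigroupI k := by
    rintro β hb0 hb1 ⟨u, rfl⟩
    rw [deg_zero_apply] at hb0
    rw [deg_one_apply] at hb1
    have hz := (Finset.sum_eq_zero_iff_of_nonneg (fun j _ => by positivity)).1 hb0
    exact hb1 (Finset.sum_eq_zero fun j hj => by simp [hz j hj])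
  rcases le_or_gt 0 (α 0) with h | h
  · refine ⟨0, ?_⟩
    have h2 : deg k 0 = 0 := by
      ext i
      simp [deg, Matrix.mulVec, dotProduct]
    rw [IsAdmissible, h2, add_zero]
    exact ⟨h, hα⟩
  · have hdeg0 : ∀ j, (α + deg k (Pi.single j (-α 0).toNat)) 0 = 0 := by
      intro j
      rw [Pi.add_apply, deg_zero_apply, ← Nat.cast_sum, Finset.sum_pi_single']
      simp
      omega
    have hdeg1 : ∀ j, (α + deg k (Pi.single j (-α 0).toNat)) 1 = α 1 + k j * (-α 0) := by
      intro j
      rw [Pi.add_apply, deg_one_apply, Finset.sum_eq_single j]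
      · have : ((-α 0).toNat : ℤ) = -α 0 := by omega
        rw [Pi.single_eq_same, this]
      · intro b _ hb
        simp [Pi.single_eq_of_ne hb]
      · simp
    by_cases h1 : α 1 = 0
    · refine ⟨_, (hdeg0 (Fin.last (m + 1))).ge, key _ (hdeg0 _) ?_⟩
      rw [hdeg1, h1, zero_add]
      have : (0 : ℤ) < k (Fin.last (m + 1)) := by exact_mod_cast hd
      exact (mul_pos this (by omega)).ne'
    · refine ⟨_, (hdeg0 0).ge, key _ (hdeg0 _) ?_⟩
      rw [hdeg1, h0]
      simpa using h1

end

end MonomialCurve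

/-! Solutions. Differentiating f(x; ρ) = 0 gives ∂_l ρ = -ρ^{k_l} / f'(ρ). By the multinomial
theorem the sum of x^u/u! · ρ^{weight u} over |u| = r is f(x; ρ)^r / r!, which vanishes for r > 0.
Together these give ∂_j ψ_ρ(β) = ψ_ρ(β - A e_j), proved in `IsRootBranch.partialD_rootFun` for
`rootFun`, which describes ψ_ρ(β) by explicit formulas for every β ∉ I(A). Hence D_w ψ_ρ(α) depends
on w only through A w; this yields both the equations D_{v⁺} = D_{v⁻} and the independence of the
choice of u. The Euler equations hold termwise by homogeneity when the first coordinate is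
nonnegative, and D_u transports them down.

Linear relations. The claim is that every relation ∑ c_j ψ_j = 0 with constant c_j has all c_j
equal; the dimension bound and the dependence criterion are then linear algebra. On a ball the
holomorphic functions form a domain. In its fraction field put K = ℂ(x); then ψ_j = G(ρ_j) for a
single rational function G over K. The Galois group of f over K is doubly transitive: for two roots
s, t the equations f(s) = f(t) = 0 are linear in x_0, x_1, so K(s, t) = ℂ(s, t, x_2, …) is purely
transcendental over ℂ, and another pair of roots yields an isomorphic extension of K
(`exists_algHom_adjoin_pair`). The gcd condition ensures s^{k_1} ≠ t^{k_1}, so that the linear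
system is solvable. Averaging the conjugate relations shows that if the c_j are not all equal, then
all ψ_j coincide.

The ψ_j do not all coincide (`not_all_rootFun_eqOn`). Otherwise, after further differentiation, some
iterated ∂_0-derivative of ρ_j^s, with s > 0, is the same for all j. Along a line in the
x_0-direction the differences ρ_i^s - ρ_j^s are then polynomials in x_0. So is the power sum of the
roots, and therefore so is ρ_i^s itself. Since x_0 is a polynomial in ρ_i, namely -f up to a
constant, this becomes a polynomial identity t^s = Q(G(t)). As m ≥ 1, there is a ≠ 0 with f(a) =
f(0), and the identity forces a^s = 0. -/

namespace MonomialCurve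
open Polynomial
open scoped ContDiff Topology
noncomputable section

/-! ### Partial derivatives on an open set -/

section Calculus

variable {n : ℕ} {U : Set (Fin n → ℂ)}

theorem partialD_congr (hU : IsOpen U) {g h : (Fin n → ℂ) → ℂ} (hgh : Set.EqOn g h U) (j : Fin n) :
    Set.EqOn (partialD j g) (partialD j h) U := by
  intro x hx
  have : g =ᶠ[𝓝 x] h := Filter.eventuallyEq_of_mem (hU.mem_nhds hx) hgh
  simp only [partialD, this.fderiv_eq]

theorem partialD_smooth (hU : IsOpen U) {g : (Fin n → ℂ) → ℂ} (hg : ContDiffOn ℂ ∞ g U) (j : Fin n) :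
    ContDiffOn ℂ ∞ (partialD j g) U :=
  (hg.fderiv_of_isOpen hU (m := ∞) (by simp)).clm_apply contDiffOn_const

theorem partialD_comm (hU : IsOpen U) {g : (Fin n → ℂ) → ℂ} (hg : ContDiffOn ℂ ∞ g U) (i j : Fin n) :
    Set.EqOn (partialD i (partialD j g)) (partialD j (partialD i g)) U := by
  intro x hx
  have hx' := hU.mem_nhds hx
  have hg' : ContDiffAt ℂ ∞ g x := hg.contDiffAt hx'
  have hs : IsSymmSndFDerivAt ℂ g x :=
    hg'.isSymmSndFDerivAt (by
      rw [minSmoothness_of_isRCLikeNormedField]; exact WithTop.coe_le_coe.2 (le_top : (2 : ℕ∞) ≤ ⊤))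
  have hd : DifferentiableAt ℂ (fderiv ℂ g) x :=
    ((hg.fderiv_of_isOpen hU (m := ∞) (by simp)).contDiffAt hx').differentiableAt (by simp)
  have key : ∀ i j : Fin n, partialD i (partialD j g) x
      = fderiv ℂ (fderiv ℂ g) x (Pi.single i 1) (Pi.single j 1) := by
    intro i j
    have := (hd.hasFDerivAt.clm_apply (hasFDerivAt_const (Pi.single j (1:ℂ) : Fin n → ℂ) x)).fderiv
    change fderiv ℂ (fun y => (fderiv ℂ g y) (Pi.single j 1)) x (Pi.single i 1) = _
    rw [this]
    simp
  rw [key, key, hs.eq]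

theorem iterate_partialD_smooth (hU : IsOpen U) {g : (Fin n → ℂ) → ℂ} (hg : ContDiffOn ℂ ∞ g U)
    (j : Fin n) (r : ℕ) : ContDiffOn ℂ ∞ ((partialD j)^[r] g) U := by
  induction r with
  | zero => exact hg
  | succ r ih => rw [Function.iterate_succ_apply']; exact partialD_smooth hU ih j

theorem iterate_partialD_congr (hU : IsOpen U) {g h : (Fin n → ℂ) → ℂ} (hgh : Set.EqOn g h U)
    (j : Fin n) (r : ℕ) : Set.EqOn ((partialD j)^[r] g) ((partialD j)^[r] h) U := by
  induction r with
  | zero => exact hgh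
  | succ r ih => simp only [Function.iterate_succ_apply']; exact partialD_congr hU ih j

theorem partialD_iterate_comm (hU : IsOpen U) {g : (Fin n → ℂ) → ℂ} (hg : ContDiffOn ℂ ∞ g U)
    (i j : Fin n) (r : ℕ) :
    Set.EqOn (partialD i ((partialD j)^[r] g)) ((partialD j)^[r] (partialD i g)) U := by
  induction r with
  | zero => exact fun _ _ => rfl
  | succ r ih =>
    simp only [Function.iterate_succ_apply']
    exact (partialD_comm hU (iterate_partialD_smooth hU hg j r) i j).trans (partialD_congr hU ih j)

/-- The composition of the powers `∂_j ^ u j` for `j` in the list `l`. -/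
def listD (l : List (Fin n)) (u : Fin n → ℕ) (g : (Fin n → ℂ) → ℂ) : (Fin n → ℂ) → ℂ :=
  l.foldr (fun j h => (partialD j)^[u j] h) g

theorem listD_smooth (hU : IsOpen U) {g : (Fin n → ℂ) → ℂ} (hg : ContDiffOn ℂ ∞ g U)
    (l : List (Fin n)) (u : Fin n → ℕ) : ContDiffOn ℂ ∞ (listD l u g) U := by
  induction l with
  | nil => exact hg
  | cons a l ih => exact iterate_partialD_smooth hU ih a (u a)

theorem listD_add_single_of_notMem (l : List (Fin n)) (u : Fin n → ℕ) (g : (Fin n → ℂ) → ℂ)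
    (j : Fin n) (hj : j ∉ l) : listD l (u + Pi.single j 1) g = listD l u g := by
  induction l with
  | nil => rfl
  | cons a l ih =>
    simp only [List.mem_cons, not_or] at hj
    have h1 : (u + Pi.single j 1 : Fin n → ℕ) a = u a := by simp [Pi.single_eq_of_ne (Ne.symm hj.1)]
    change (partialD a)^[(u + Pi.single j 1 : Fin n → ℕ) a] (listD l (u + Pi.single j 1) g) = _
    rw [ih hj.2, h1]; rfl

/-- Symmetry of second derivatives moves the extra `∂_j` to the outside; since the list has no
repetitions, exactly one factor absorbs it. -/
theorem listD_add_single (hU : IsOpen U) {g : (Fin n → ℂ) → ℂ} (hg : ContDiffOn ℂ ∞ g U)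
    (l : List (Fin n)) (hl : l.Nodup) (u : Fin n → ℕ) (j : Fin n) (hj : j ∈ l) :
    Set.EqOn (listD l (u + Pi.single j 1) g) (partialD j (listD l u g)) U := by
  induction l with
  | nil => simp at hj
  | cons a l ih =>
    rw [List.nodup_cons] at hl
    change Set.EqOn ((partialD a)^[(u + Pi.single j 1 : Fin n → ℕ) a] (listD l (u + Pi.single j 1) g))
      (partialD j ((partialD a)^[u a] (listD l u g))) U
    by_cases hja : j = a
    · subst hja
      rw [listD_add_single_of_notMem l u g j hl.1, Pi.add_apply, Pi.single_eq_same,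
        Function.iterate_succ_apply']
      exact fun _ _ => rfl
    · have hj' : j ∈ l := by simpa [hja] using hj
      have h1 : (u + Pi.single j 1 : Fin n → ℕ) a = u a := by simp [Pi.single_eq_of_ne (Ne.symm hja)]
      rw [h1]
      exact (iterate_partialD_congr hU (ih hl.2 hj') a (u a)).trans
        (partialD_iterate_comm hU (listD_smooth hU hg l u) j a (u a)).symm

theorem iterD_smooth (hU : IsOpen U) {g : (Fin n → ℂ) → ℂ} (hg : ContDiffOn ℂ ∞ g U)
    (u : Fin n → ℕ) : ContDiffOn ℂ ∞ (iterD u g) U :=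
  listD_smooth hU hg _ u

theorem iterD_add_single (hU : IsOpen U) {g : (Fin n → ℂ) → ℂ} (hg : ContDiffOn ℂ ∞ g U)
    (u : Fin n → ℕ) (j : Fin n) :
    Set.EqOn (iterD (u + Pi.single j 1) g) (partialD j (iterD u g)) U :=
  listD_add_single hU hg _ (List.nodup_finRange n) u j (List.mem_finRange j)

theorem multiIndex_induction {p : (Fin n → ℕ) → Prop} (h0 : p 0)
    (hs : ∀ u j, p u → p (u + Pi.single j 1)) (u : Fin n → ℕ) : p u := by
  induction h : ∑ j, u j generalizing u with
  | zero =>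
    have : u = 0 := by
      funext j
      exact (Finset.sum_eq_zero_iff.1 h) j (Finset.mem_univ j)
    rwa [this]
  | succ r ih =>
    obtain ⟨j, hj⟩ : ∃ j, u j ≠ 0 := by
      by_contra! hc
      simp [hc] at h
    have hu : u = (u - Pi.single j 1) + Pi.single j 1 := by
      refine (tsub_add_cancel_of_le ?_).symm
      intro i
      by_cases hi : i = j
      · subst hi; simp; omega
      · simp [Pi.single_eq_of_ne hi]
    rw [hu]
    refine hs _ _ (ih _ ?_)
    rw [hu] at h
    simp only [Pi.add_apply, Finset.sum_add_distrib, Finset.sum_pi_single', Finset.mem_univ,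
      if_true] at h
    omega

theorem iterD_congr (hU : IsOpen U) {g h : (Fin n → ℂ) → ℂ} (hgh : Set.EqOn g h U)
    (u : Fin n → ℕ) : Set.EqOn (iterD u g) (iterD u h) U := by
  unfold iterD
  induction List.finRange n with
  | nil => exact hgh
  | cons a l ih => exact iterate_partialD_congr hU ih a (u a)

theorem partialD_eq_of_hasFDerivAt {g : (Fin n → ℂ) → ℂ} {g' : (Fin n → ℂ) →L[ℂ] ℂ}
    {x : Fin n → ℂ} (h : HasFDerivAt g g' x) (j : Fin n) : partialD j g x = g' (Pi.single j 1) := by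
  rw [partialD, h.fderiv]

theorem partialD_add {g h : (Fin n → ℂ) → ℂ} {x : Fin n → ℂ} (hg : DifferentiableAt ℂ g x)
    (hh : DifferentiableAt ℂ h x) (j : Fin n) :
    partialD j (g + h) x = partialD j g x + partialD j h x := by
  rw [partialD_eq_of_hasFDerivAt (hg.hasFDerivAt.add hh.hasFDerivAt)]; rfl

theorem partialD_sub {g h : (Fin n → ℂ) → ℂ} {x : Fin n → ℂ} (hg : DifferentiableAt ℂ g x)
    (hh : DifferentiableAt ℂ h x) (j : Fin n) :
    partialD j (g - h) x = partialD j g x - partialD j h x := by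
  rw [partialD_eq_of_hasFDerivAt (hg.hasFDerivAt.sub hh.hasFDerivAt)]; rfl

theorem partialD_mul {g h : (Fin n → ℂ) → ℂ} {x : Fin n → ℂ} (hg : DifferentiableAt ℂ g x)
    (hh : DifferentiableAt ℂ h x) (j : Fin n) :
    partialD j (g * h) x = partialD j g x * h x + g x * partialD j h x := by
  rw [partialD_eq_of_hasFDerivAt (hg.hasFDerivAt.mul hh.hasFDerivAt)]
  simp [partialD]; ring

theorem partialD_const (c : ℂ) (x : Fin n → ℂ) (j : Fin n) : partialD j (fun _ => c) x = 0 := by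
  rw [partialD_eq_of_hasFDerivAt (hasFDerivAt_const c x)]; rfl

theorem partialD_coord (i j : Fin n) (x : Fin n → ℂ) :
    partialD j (fun x => x i) x = if i = j then 1 else 0 := by
  rw [partialD_eq_of_hasFDerivAt (hasFDerivAt_apply i x)]
  simp [Pi.single_apply]

theorem partialD_sum {ι : Type*} (s : Finset ι) {g : ι → (Fin n → ℂ) → ℂ} {x : Fin n → ℂ}
    (hg : ∀ i ∈ s, DifferentiableAt ℂ (g i) x) (j : Fin n) :
    partialD j (fun x => ∑ i ∈ s, g i x) x = ∑ i ∈ s, partialD j (g i) x := by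
  rw [partialD_eq_of_hasFDerivAt (HasFDerivAt.fun_sum fun i hi => (hg i hi).hasFDerivAt)]
  simp [partialD]

theorem partialD_comp {g : (Fin n → ℂ) → ℂ} {x : Fin n → ℂ} (hg : DifferentiableAt ℂ g x)
    {h : ℂ → ℂ} {h' : ℂ} (hh : HasDerivAt h h' (g x)) (j : Fin n) :
    partialD j (fun x => h (g x)) x = h' * partialD j g x := by
  have := partialD_eq_of_hasFDerivAt (hh.comp_hasFDerivAt x hg.hasFDerivAt) j
  simpa [partialD, Function.comp_def] using this

theorem partialD_inv {g : (Fin n → ℂ) → ℂ} {x : Fin n → ℂ} (hg : DifferentiableAt ℂ g x)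
    (h0 : g x ≠ 0) (j : Fin n) :
    partialD j (fun x => (g x)⁻¹) x = -partialD j g x * ((g x)⁻¹ * (g x)⁻¹) := by
  rw [partialD_comp hg (hasDerivAt_inv h0)]
  field_simp

theorem partialD_zpow {g : (Fin n → ℂ) → ℂ} {x : Fin n → ℂ} (hg : DifferentiableAt ℂ g x)
    (h0 : g x ≠ 0) (s : ℤ) (j : Fin n) :
    partialD j (fun x => g x ^ s) x = s * g x ^ (s - 1) * partialD j g x :=
  partialD_comp hg (hasDerivAt_zpow s _ (Or.inl h0)) j

theorem partialD_pow {g : (Fin n → ℂ) → ℂ} {x : Fin n → ℂ} (hg : DifferentiableAt ℂ g x)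
    (s : ℕ) (j : Fin n) :
    partialD j (fun x => g x ^ s) x = s * g x ^ (s - 1) * partialD j g x :=
  partialD_comp hg (hasDerivAt_pow s _) j

end Calculus

/-! ### Divided power monomials -/

section Monomials

variable {n : ℕ}

/-- The divided power monomial `x^u / u!`. -/
def divMonomial (u : Fin n → ℕ) (x : Fin n → ℂ) : ℂ := ∏ j, x j ^ u j / ((u j).factorial : ℂ)

theorem divMonomial_contDiff (u : Fin n → ℕ) : ContDiff ℂ ∞ (divMonomial u) := by
  unfold divMonomial
  fun_prop

theorem partialD_divMonomial (u : Fin n → ℕ) (j : Fin n) (x : Fin n → ℂ) :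
    partialD j (divMonomial u) x = (∏ l ∈ Finset.univ.erase j, x l ^ u l / ((u l).factorial : ℂ)) *
      (u j * x j ^ (u j - 1) / ((u j).factorial : ℂ)) := by
  have h : ∀ l : Fin n, HasFDerivAt (fun x : Fin n → ℂ => x l ^ u l / ((u l).factorial : ℂ))
      ((u l * x l ^ (u l - 1) / ((u l).factorial : ℂ)) •
        (ContinuousLinearMap.proj l : (Fin n → ℂ) →L[ℂ] ℂ)) x := by
    intro l
    have hl : HasFDerivAt (fun f : Fin n → ℂ => f l)
        (ContinuousLinearMap.proj l : (Fin n → ℂ) →L[ℂ] ℂ) x := hasFDerivAt_apply l x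
    have hp := (hasDerivAt_pow (u l) (x l)).div_const ((u l).factorial : ℂ)
    exact HasDerivAt.comp_hasFDerivAt (h₂ := fun z : ℂ => z ^ u l / ((u l).factorial : ℂ))
      (f := fun f : Fin n → ℂ => f l) x hp hl
  have h2 := partialD_eq_of_hasFDerivAt (HasFDerivAt.finsetProd (u := Finset.univ)
    fun l _ => h l) j
  have h3 : divMonomial u = fun x => ∏ l, x l ^ u l / ((u l).factorial : ℂ) := rfl
  rw [h3, h2, _root_.sum_apply, Finset.sum_eq_single j]
  · simp
  · intro l _ hl
    simp [Pi.single_eq_of_ne hl]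
  · simp

theorem partialD_divMonomial_add_single (u : Fin n → ℕ) (j : Fin n) (x : Fin n → ℂ) :
    partialD j (divMonomial (u + Pi.single j 1)) x = divMonomial u x := by
  rw [partialD_divMonomial, divMonomial, ← Finset.prod_erase_mul _ _ (Finset.mem_univ j)]
  congr 1
  · refine Finset.prod_congr rfl fun l hl => ?_
    simp [Pi.single_eq_of_ne (Finset.ne_of_mem_erase hl)]
  · have h1 : ((u j).factorial : ℂ) ≠ 0 := by exact_mod_cast (u j).factorial_ne_zero
    have h2 : (u j + 1 : ℂ) ≠ 0 := by exact_mod_cast (u j).succ_ne_zero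
    simp [Nat.factorial_succ]
    field_simp

theorem partialD_divMonomial_of_eq_zero (u : Fin n → ℕ) (j : Fin n) (hj : u j = 0)
    (x : Fin n → ℂ) : partialD j (divMonomial u) x = 0 := by
  rw [partialD_divMonomial, hj]; simp

theorem mul_partialD_divMonomial (u : Fin n → ℕ) (j : Fin n) (x : Fin n → ℂ) :
    x j * partialD j (divMonomial u) x = u j * divMonomial u x := by
  rw [partialD_divMonomial, divMonomial, ← Finset.prod_erase_mul _ _ (Finset.mem_univ j)]
  rcases Nat.eq_zero_or_pos (u j) with h | h
  · simp [h]
  · have : x j ^ u j = x j ^ (u j - 1) * x j := by rw [← pow_succ]; congr 1; omega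
    rw [this]; ring

/-- Since ∂_j takes x^u/u! to x^{u-e_j}/(u-e_j)!, or to 0 if u_j = 0, this is a reindexing by u ↦ u
+ e_j. -/
theorem sum_partialD_divMonomial_mul (r : ℕ) (j : Fin n) (x : Fin n → ℂ) (h : (Fin n → ℕ) → ℂ) :
    ∑ u ∈ Finset.univ.piAntidiag (r + 1), partialD j (divMonomial u) x * h u =
      ∑ u ∈ Finset.univ.piAntidiag r, divMonomial u x * h (u + Pi.single j 1) := by
  symm
  refine Finset.sum_of_injOn (fun u => u + Pi.single j 1) (fun a _ b _ hab => add_right_cancel hab)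
    ?_ ?_ ?_
  · intro u hu
    have hu' : ∑ j, u j = r := by simpa using hu
    simp [Finset.sum_add_distrib, hu']
  · intro u hu hu'
    by_cases hj : u j = 0
    · rw [partialD_divMonomial_of_eq_zero u j hj, zero_mul]
    · exfalso
      apply hu'
      have hu2 : (u - Pi.single j 1) + Pi.single j 1 = u := by
        refine tsub_add_cancel_of_le fun i => ?_
        by_cases hi : i = j
        · subst hi; simp; omega
        · simp [Pi.single_eq_of_ne hi]
      refine ⟨u - Pi.single j 1, ?_, hu2⟩
      rw [← hu2] at hu
      simpa [Finset.sum_add_distrib] using hu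
  · intro u _
    simp only [partialD_divMonomial_add_single]

/-- The multinomial theorem in divided powers; with y_j = ρ^{k_j} the right side is f(x; ρ)^r / r!.
-/
theorem sum_divMonomial_mul_prod_pow (r : ℕ) (x : Fin n → ℂ) (y : Fin n → ℂ) :
    ∑ u ∈ Finset.univ.piAntidiag r, divMonomial u x * ∏ j, y j ^ u j =
      (∑ j, x j * y j) ^ r / (r.factorial : ℂ) := by
  rw [Finset.sum_pow_eq_sum_piAntidiag, Finset.sum_div]
  refine Finset.sum_congr rfl fun u hu => ?_
  have hs : ∑ j, u j = r := by simpa using hu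
  have h := Nat.multinomial_spec Finset.univ u
  rw [hs] at h
  have h' : (∏ j, ((u j).factorial : ℂ)) * (Nat.multinomial Finset.univ u : ℂ) = r.factorial := by
    exact_mod_cast h
  have h1 : (r.factorial : ℂ) ≠ 0 := by exact_mod_cast r.factorial_ne_zero
  have h2 : (∏ j, ((u j).factorial : ℂ)) ≠ 0 :=
    Finset.prod_ne_zero_iff.2 fun j _ => by exact_mod_cast (u j).factorial_ne_zero
  simp only [divMonomial, Finset.prod_div_distrib, mul_pow, Finset.prod_mul_distrib]
  have h3 : (Nat.multinomial Finset.univ u : ℂ) ≠ 0 := by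
    intro h3
    rw [h3, mul_zero] at h'
    exact h1 h'.symm
  rw [← h']
  field_simp

end Monomials

/-! ### Degrees and the derivatives of a root -/

section Degrees

variable {m : ℕ}

theorem deg_add (k u v : Fin (m + 2) → ℕ) : deg k (u + v) = deg k u + deg k v := by
  simp only [deg, ← Matrix.mulVec_add]
  congr 1

theorem deg_zero (k : Fin (m + 2) → ℕ) : deg k 0 = 0 := by
  ext i
  simp [deg, Matrix.mulVec, dotProduct]

theorem deg_single_zero (k : Fin (m + 2) → ℕ) (j : Fin (m + 2)) : deg k (Pi.single j 1) 0 = 1 := by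
  rw [deg_zero_apply, ← Nat.cast_sum, Finset.sum_pi_single']
  simp

theorem deg_single_one (k : Fin (m + 2) → ℕ) (j : Fin (m + 2)) :
    deg k (Pi.single j 1) 1 = k j := by
  rw [deg_one_apply, Finset.sum_eq_single j]
  · simp
  · intro b _ hb
    simp [Pi.single_eq_of_ne hb]
  · simp

theorem sub_deg_notMem (k : Fin (m + 2) → ℕ) {β : Fin 2 → ℤ} (hβ : β ∉ semigroupI k)
    (u : Fin (m + 2) → ℕ) : β - deg k u ∉ semigroupI k := by
  rintro ⟨v, hv⟩
  exact hβ ⟨v + u, by rw [deg_add, hv, sub_add_cancel]⟩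

/-- The value at `x` of the derivative of `f(x; t)` with respect to `t` at `t = ρ x`. -/
def derivAtRoot (k : Fin (m + 2) → ℕ) (ρ : (Fin (m + 2) → ℂ) → ℂ) (x : Fin (m + 2) → ℂ) : ℂ :=
  ∑ j, x j * (k j * ρ x ^ (k j - 1))

/-- `ρ` is a holomorphic branch on `U` of the nonzero simple roots of `f(x; t)`. -/
structure IsRootBranch (k : Fin (m + 2) → ℕ) (U : Set (Fin (m + 2) → ℂ))
    (ρ : (Fin (m + 2) → ℂ) → ℂ) : Prop where
  diff : DifferentiableOn ℂ ρ U
  ne_zero : ∀ x ∈ U, ρ x ≠ 0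
  root : ∀ x ∈ U, ∑ j, x j * ρ x ^ k j = 0
  deriv_ne_zero : ∀ x ∈ U, derivAtRoot k ρ x ≠ 0

section Branch

variable {k : Fin (m + 2) → ℕ} {U : Set (Fin (m + 2) → ℂ)} {ρ : (Fin (m + 2) → ℂ) → ℂ}

theorem IsRootBranch.mono (h : IsRootBranch k U ρ) {V : Set (Fin (m + 2) → ℂ)} (hV : V ⊆ U) :
    IsRootBranch k V ρ :=
  ⟨h.diff.mono hV, fun x hx => h.ne_zero x (hV hx), fun x hx => h.root x (hV hx),
    fun x hx => h.deriv_ne_zero x (hV hx)⟩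

theorem IsRootBranch.differentiableAt (hU : IsOpen U) (h : IsRootBranch k U ρ)
    {x : Fin (m + 2) → ℂ} (hx : x ∈ U) : DifferentiableAt ℂ ρ x :=
  h.diff.differentiableAt (hU.mem_nhds hx)

/-- Implicit differentiation of f(x; ρ(x)) = 0. -/
theorem IsRootBranch.partialD_eq (hU : IsOpen U) (h : IsRootBranch k U ρ)
    {x : Fin (m + 2) → ℂ} (hx : x ∈ U) (l : Fin (m + 2)) :
    partialD l ρ x = -ρ x ^ k l * (derivAtRoot k ρ x)⁻¹ := by
  have hd := h.differentiableAt hU hx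
  have h0 : partialD l (fun x => ∑ j, x j * ρ x ^ k j) x = 0 := by
    rw [partialD_congr hU (fun y hy => h.root y hy) l hx, partialD_const]
  have hdc : ∀ j, DifferentiableAt ℂ (fun x : Fin (m + 2) → ℂ => x j) x := fun j => by fun_prop
  have hdp : ∀ j, DifferentiableAt ℂ (fun x : Fin (m + 2) → ℂ => ρ x ^ k j) x :=
    fun j => hd.pow _
  rw [partialD_sum Finset.univ (g := fun j x => x j * ρ x ^ k j)
    (fun j _ => (hdc j).mul (hdp j))] at h0
  have h1 : ∀ j, partialD l (fun x => x j * ρ x ^ k j) x =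
      (if j = l then 1 else 0) * ρ x ^ k j + x j * (k j * ρ x ^ (k j - 1) * partialD l ρ x) := by
    intro j
    rw [← partialD_coord, ← partialD_pow hd]
    exact partialD_mul (hdc j) (hdp j) l
  simp only [h1, Finset.sum_add_distrib, ite_mul, one_mul, zero_mul, Finset.sum_ite_eq',
    Finset.mem_univ, if_true] at h0
  have h2 : ∑ j, x j * (k j * ρ x ^ (k j - 1) * partialD l ρ x) =
      derivAtRoot k ρ x * partialD l ρ x := by
    rw [derivAtRoot, Finset.sum_mul]
    exact Finset.sum_congr rfl fun j _ => by ring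
  rw [h2] at h0
  have := h.deriv_ne_zero x hx
  field_simp
  linear_combination h0

theorem derivAtRoot_contDiffOn {N : ℕ∞ω} (h : ContDiffOn ℂ N ρ U) :
    ContDiffOn ℂ N (derivAtRoot k ρ) U := by
  unfold derivAtRoot
  fun_prop

/-- Bootstrapping: the derivative of ρ is a rational expression in x and ρ, so it is C^N as soon as
ρ is, and then ρ is C^{N+1}. -/
theorem IsRootBranch.smooth (hU : IsOpen U) (h : IsRootBranch k U ρ) : ContDiffOn ℂ ∞ ρ U := by
  rw [contDiffOn_infty]
  intro N
  induction N with
  | zero => exact contDiffOn_zero.2 h.diff.continuousOn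
  | succ N ih =>
    push_cast
    rw [contDiffOn_succ_iff_fderiv_of_isOpen hU]
    refine ⟨h.diff, by simp, ?_⟩
    have h1 : ContDiffOn ℂ N (fun x => ∑ l : Fin (m + 2),
        (-ρ x ^ k l * (derivAtRoot k ρ x)⁻¹) •
          (ContinuousLinearMap.proj l : (Fin (m + 2) → ℂ) →L[ℂ] ℂ)) U := by
      refine ContDiffOn.sum fun l _ => ContDiffOn.fun_smul ?_ contDiffOn_const
      exact (ih.pow _).neg.mul ((derivAtRoot_contDiffOn ih).inv h.deriv_ne_zero)
    refine h1.congr fun x hx => ?_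
    refine ContinuousLinearMap.ext fun v => ?_
    conv_lhs => rw [← Finset.univ_sum_single v]
    rw [map_sum, _root_.sum_apply]
    refine Finset.sum_congr rfl fun l _ => ?_
    have : (Pi.single l (v l) : Fin (m + 2) → ℂ) = v l • Pi.single l 1 := by
      rw [← Pi.single_smul]; simp
    rw [this, map_smul, ← h.partialD_eq hU hx l]
    simp [partialD, mul_comm]

theorem IsRootBranch.partialD_eq_pow_mul (hU : IsOpen U) (hk0 : k 0 = 0) (h : IsRootBranch k U ρ)
    {x : Fin (m + 2) → ℂ} (hx : x ∈ U) (l : Fin (m + 2)) :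
    partialD l ρ x = ρ x ^ k l * partialD 0 ρ x := by
  rw [h.partialD_eq hU hx, h.partialD_eq hU hx, hk0]
  ring

theorem IsRootBranch.partialD_ne_zero (hU : IsOpen U) (h : IsRootBranch k U ρ)
    {x : Fin (m + 2) → ℂ} (hx : x ∈ U) (l : Fin (m + 2)) : partialD l ρ x ≠ 0 := by
  rw [h.partialD_eq hU hx]
  exact mul_ne_zero (neg_ne_zero.2 (pow_ne_zero _ (h.ne_zero x hx)))
    (inv_ne_zero (h.deriv_ne_zero x hx))

/-- Roots are homogeneous of degree 0 in x: the sum equals -f(ρ)/f'(ρ). -/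
theorem IsRootBranch.sum_mul_partialD (hU : IsOpen U) (h : IsRootBranch k U ρ)
    {x : Fin (m + 2) → ℂ} (hx : x ∈ U) : ∑ l, x l * partialD l ρ x = 0 := by
  have := h.root x hx
  calc ∑ l, x l * partialD l ρ x = ∑ l, (x l * ρ x ^ k l) * -(derivAtRoot k ρ x)⁻¹ :=
        Finset.sum_congr rfl fun l _ => by rw [h.partialD_eq hU hx]; ring
    _ = 0 := by rw [← Finset.sum_mul, this, zero_mul]

/-- Roots have weight -1 when x_l has weight k_l: the sum equals -ρ f'(ρ)/f'(ρ). -/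
theorem IsRootBranch.sum_mul_mul_partialD (hU : IsOpen U) (h : IsRootBranch k U ρ)
    {x : Fin (m + 2) → ℂ} (hx : x ∈ U) : ∑ l, (k l : ℂ) * x l * partialD l ρ x = -ρ x := by
  have h1 : ∀ l, (k l : ℂ) * ρ x ^ k l = k l * ρ x ^ (k l - 1) * ρ x := by
    intro l
    rcases Nat.eq_zero_or_pos (k l) with h | h
    · simp [h]
    · rw [mul_assoc, ← pow_succ]; congr 2; omega
  have h2 : ∑ l, (k l : ℂ) * x l * ρ x ^ k l = derivAtRoot k ρ x * ρ x := by
    rw [derivAtRoot, Finset.sum_mul]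
    refine Finset.sum_congr rfl fun l _ => ?_
    linear_combination x l * h1 l
  calc ∑ l, (k l : ℂ) * x l * partialD l ρ x
      = ∑ l, ((k l : ℂ) * x l * ρ x ^ k l) * -(derivAtRoot k ρ x)⁻¹ :=
        Finset.sum_congr rfl fun l _ => by rw [h.partialD_eq hU hx]; ring
    _ = -ρ x := by
        rw [← Finset.sum_mul, h2]
        have := h.deriv_ne_zero x hx
        field_simp

end Branch

end Degrees

/-! ### The functions ψ_ρ solve the hypergeometric system -/

section Solutions

variable {m : ℕ}

/-- The weight `∑ⱼ kⱼ uⱼ` of a multi-index. -/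
def weight (k u : Fin (m + 2) → ℕ) : ℕ := ∑ j, k j * u j

theorem deg_one_eq_weight (k u : Fin (m + 2) → ℕ) : deg k u 1 = weight k u := by
  rw [deg_one_apply, weight]; push_cast; rfl

theorem deg_zero_of_mem_piAntidiag (k : Fin (m + 2) → ℕ) {r : ℕ} {u : Fin (m + 2) → ℕ}
    (hu : u ∈ Finset.univ.piAntidiag r) : deg k u 0 = r := by
  have hs : ∑ j, u j = r := by simpa using hu
  rw [deg_zero_apply, ← hs]; push_cast; rfl

theorem weight_add_single (k u : Fin (m + 2) → ℕ) (j : Fin (m + 2)) :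
    weight k (u + Pi.single j 1) = weight k u + k j := by
  have := deg_one_eq_weight k (u + Pi.single j 1)
  rw [deg_add, Pi.add_apply, deg_single_one, deg_one_eq_weight] at this
  exact_mod_cast this.symm

theorem weight_zero (k : Fin (m + 2) → ℕ) : weight k 0 = 0 := by simp [weight]

theorem prod_pow_mul_eq_pow_weight (k u : Fin (m + 2) → ℕ) (r : ℂ) :
    ∏ j, (r ^ k j) ^ u j = r ^ weight k u := by
  simp only [weight, ← pow_mul, Finset.prod_pow_eq_pow_sum]

theorem weight_le {k : Fin (m + 2) → ℕ} (hk : StrictMono k) {r : ℕ} {u : Fin (m + 2) → ℕ}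
    (hu : u ∈ Finset.univ.piAntidiag r) : weight k u ≤ k (Fin.last (m + 1)) * r := by
  have hs : ∑ j, u j = r := by simpa using hu
  rw [weight, ← hs, Finset.mul_sum]
  exact Finset.sum_le_sum fun j _ => Nat.mul_le_mul_right _ (hk.monotone (Fin.le_last j))

/-- This is how β ∉ I(A) enters: no denominator in `powerSum` vanishes. -/
theorem weight_ne {k : Fin (m + 2) → ℕ} {β : Fin 2 → ℤ} (h0 : 0 ≤ β 0) (hβ : β ∉ semigroupI k)
    {u : Fin (m + 2) → ℕ} (hu : u ∈ Finset.univ.piAntidiag (β 0).toNat) :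
    (weight k u : ℤ) - β 1 ≠ 0 := by
  intro h
  refine hβ ⟨u, ?_⟩
  funext i
  fin_cases i
  · have := deg_zero_of_mem_piAntidiag k hu
    simp only [Fin.zero_eta]
    omega
  · have := deg_one_eq_weight k u
    simp only [Fin.mk_one]
    omega

/-- `∑ x^u/u! · ρ^s/s` over the multi-indices `u` of length `r`, where `s` is the weight of `u`
minus `c`. -/
def powerSum (k : Fin (m + 2) → ℕ) (ρ : (Fin (m + 2) → ℂ) → ℂ) (r : ℕ) (c : ℤ)
    (x : Fin (m + 2) → ℂ) : ℂ :=
  ∑ u ∈ Finset.univ.piAntidiag r,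
    divMonomial u x * (ρ x ^ ((weight k u : ℤ) - c) / (((weight k u : ℤ) - c : ℤ) : ℂ))

/-- Grouping the multi-indices by weight recovers the sum over i: each weight lies between 0 and d
β_0 and differs from β_1, so no multi-index is lost. -/
theorem psiNonneg_eq_powerSum {k : Fin (m + 2) → ℕ} (hk : StrictMono k)
    (ρ : (Fin (m + 2) → ℂ) → ℂ) {β : Fin 2 → ℤ} (h0 : 0 ≤ β 0) (hβ : β ∉ semigroupI k) :
    psiNonneg k ρ β = powerSum k ρ (β 0).toNat (β 1) := by
  funext x
  rw [psiNonneg, powerSum, ← Finset.sum_fiberwise_of_maps_to (g := fun u => weight k u)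
    (t := (Finset.range (k (Fin.last (m + 1)) * (β 0).toNat + 1)).filter
      (fun i : ℕ => (i : ℤ) ≠ β 1))]
  · refine Finset.sum_congr rfl fun i _ => ?_
    rw [hypPoly, Finset.sum_mul]
    refine Finset.sum_congr ?_ fun u hu => ?_
    · ext u
      simp only [fiber, Matrix.cons_val_zero, Finset.mem_filter, and_congr_right_iff]
      intro hu
      have h1 := deg_zero_of_mem_piAntidiag k hu
      have h2 := deg_one_eq_weight k u
      constructor
      · intro h
        have := congrFun h 1
        simp only [Matrix.cons_val_one, Matrix.cons_val_fin_one] at this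
        omega
      · rintro rfl
        funext i
        fin_cases i
        · simp only [Fin.zero_eta, Matrix.cons_val_zero]; omega
        · simp only [Fin.mk_one, Matrix.cons_val_one, Matrix.cons_val_fin_one]; omega
    · rw [← (Finset.mem_filter.1 hu).2]
      rfl
  · intro u hu
    have h1 := weight_le hk hu
    have h2 := weight_ne h0 hβ hu
    simp only [Finset.mem_filter, Finset.mem_range]
    omega

section Branch

variable {k : Fin (m + 2) → ℕ} {U : Set (Fin (m + 2) → ℂ)} {ρ : (Fin (m + 2) → ℂ) → ℂ}

theorem IsRootBranch.zpow_smooth (hU : IsOpen U) (h : IsRootBranch k U ρ) (s : ℤ) :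
    ContDiffOn ℂ ∞ (fun x => ρ x ^ s) U := by
  rcases Int.le_total 0 s with hs | hs
  · lift s to ℕ using hs
    simpa using (h.smooth hU).pow s
  · obtain ⟨t, rfl⟩ : ∃ t : ℕ, s = -t := ⟨(-s).toNat, by omega⟩
    simp only [zpow_neg, zpow_natCast]
    exact ((h.smooth hU).pow t).inv fun x hx => pow_ne_zero _ (h.ne_zero x hx)

theorem IsRootBranch.powerSum_smooth (hU : IsOpen U) (h : IsRootBranch k U ρ) (r : ℕ) (c : ℤ) :
    ContDiffOn ℂ ∞ (powerSum k ρ r c) U := by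
  unfold powerSum
  exact ContDiffOn.sum fun u _ => (divMonomial_contDiff u).contDiffOn.mul
    ((h.zpow_smooth hU _).div_const _)

theorem IsRootBranch.partialD_zpow_div (hU : IsOpen U) (h : IsRootBranch k U ρ) {s : ℤ}
    (hs : s ≠ 0) {x : Fin (m + 2) → ℂ} (hx : x ∈ U) (j : Fin (m + 2)) :
    partialD j (fun x => ρ x ^ s / (s : ℂ)) x = ρ x ^ (s - 1) * partialD j ρ x := by
  have hs' : (s : ℂ) ≠ 0 := by exact_mod_cast hs
  rw [partialD_comp (h.differentiableAt hU hx)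
    ((hasDerivAt_zpow s _ (Or.inl (h.ne_zero x hx))).div_const (s : ℂ))]
  field_simp

theorem IsRootBranch.partialD_powerSum_aux (hU : IsOpen U) (h : IsRootBranch k U ρ) (r : ℕ) (c : ℤ)
    (hc : ∀ u ∈ Finset.univ.piAntidiag r, (weight k u : ℤ) - c ≠ 0)
    {x : Fin (m + 2) → ℂ} (hx : x ∈ U) (j : Fin (m + 2)) :
    partialD j (powerSum k ρ r c) x =
      ∑ u ∈ Finset.univ.piAntidiag r, (partialD j (divMonomial u) x *
        (ρ x ^ ((weight k u : ℤ) - c) / (((weight k u : ℤ) - c : ℤ) : ℂ)) +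
        divMonomial u x * (ρ x ^ ((weight k u : ℤ) - c - 1) * partialD j ρ x)) := by
  have hd : ∀ u : Fin (m + 2) → ℕ, DifferentiableAt ℂ (divMonomial u) x := fun u =>
    (divMonomial_contDiff u).contDiffAt.differentiableAt (by simp)
  have hz : ∀ s : ℤ, DifferentiableAt ℂ (fun x => ρ x ^ s / (s : ℂ)) x := fun s =>
    (((h.zpow_smooth hU s).div_const _).contDiffAt (hU.mem_nhds hx)).differentiableAt (by simp)
  have := partialD_sum (Finset.univ.piAntidiag r) (g := fun u x => divMonomial u x *
    (ρ x ^ ((weight k u : ℤ) - c) / (((weight k u : ℤ) - c : ℤ) : ℂ))) (x := x)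
    (fun u _ => (hd u).mul (hz _)) j
  change partialD j (fun x => ∑ u ∈ Finset.univ.piAntidiag r, divMonomial u x *
    (ρ x ^ ((weight k u : ℤ) - c) / (((weight k u : ℤ) - c : ℤ) : ℂ))) x = _
  rw [this]
  refine Finset.sum_congr rfl fun u hu => ?_
  rw [← h.partialD_zpow_div hU (hc u hu) hx]
  exact partialD_mul (hd u) (hz _) j

theorem IsRootBranch.sum_divMonomial_mul_pow (h : IsRootBranch k U ρ) (r : ℕ)
    {x : Fin (m + 2) → ℂ} (hx : x ∈ U) :
    ∑ u ∈ Finset.univ.piAntidiag (r + 1), divMonomial u x * ρ x ^ weight k u = 0 := by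
  have := sum_divMonomial_mul_prod_pow (r + 1) x (fun j => ρ x ^ k j)
  simp only [prod_pow_mul_eq_pow_weight] at this
  rw [this, h.root x hx]
  simp

/-- In the product rule, differentiating ρ^s/s cancels the denominator, so these terms add up to a
multiple of f(x; ρ)^{r+1}/(r+1)! = 0. The terms where the monomial is differentiated give the right
side. -/
theorem IsRootBranch.partialD_powerSum (hU : IsOpen U) (h : IsRootBranch k U ρ) (r : ℕ) (c : ℤ)
    (hc : ∀ u ∈ Finset.univ.piAntidiag (r + 1), (weight k u : ℤ) - c ≠ 0) (j : Fin (m + 2)) :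
    Set.EqOn (partialD j (powerSum k ρ (r + 1) c)) (powerSum k ρ r (c - k j)) U := by
  intro x hx
  rw [h.partialD_powerSum_aux hU (r + 1) c hc hx, Finset.sum_add_distrib,
    sum_partialD_divMonomial_mul]
  have h1 : ∑ u ∈ Finset.univ.piAntidiag (r + 1),
      divMonomial u x * (ρ x ^ ((weight k u : ℤ) - c - 1) * partialD j ρ x) = 0 := by
    have h2 := h.sum_divMonomial_mul_pow r hx
    calc _ = ∑ u ∈ Finset.univ.piAntidiag (r + 1), (divMonomial u x * ρ x ^ weight k u) *
          (ρ x ^ (-c - 1) * partialD j ρ x) := by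
          refine Finset.sum_congr rfl fun u _ => ?_
          have : (weight k u : ℤ) - c - 1 = weight k u + (-c - 1) := by ring
          rw [this, zpow_add₀ (h.ne_zero x hx), zpow_natCast]
          ring
      _ = 0 := by rw [← Finset.sum_mul, h2, zero_mul]
  rw [h1, add_zero, powerSum]
  refine Finset.sum_congr rfl fun u _ => ?_
  rw [weight_add_single]
  have : ((weight k u + k j : ℕ) : ℤ) - c = weight k u - (c - k j) := by push_cast; ring
  rw [this]

/-- The function `ρ^(s-1) ∂ρ/∂x₀`, the derivative of `ρ^s/s` (of `log ρ` if `s = 0`). -/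
def powDeriv (ρ : (Fin (m + 2) → ℂ) → ℂ) (s : ℤ) (x : Fin (m + 2) → ℂ) : ℂ :=
  ρ x ^ (s - 1) * partialD 0 ρ x

theorem IsRootBranch.powDeriv_smooth (hU : IsOpen U) (h : IsRootBranch k U ρ) (s : ℤ) :
    ContDiffOn ℂ ∞ (powDeriv ρ s) U :=
  (h.zpow_smooth hU _).mul (partialD_smooth hU (h.smooth hU) 0)

theorem powerSum_zero (k : Fin (m + 2) → ℕ) (ρ : (Fin (m + 2) → ℂ) → ℂ) (c : ℤ) :
    powerSum k ρ 0 c = fun x => ρ x ^ (-c) / ((-c : ℤ) : ℂ) := by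
  funext x
  simp [powerSum, weight_zero, divMonomial]

/-- At r = 0 the power of f is f^0 = 1, so nothing cancels and the derivative of ρ^{-c}/(-c)
survives; ∂_j ρ = ρ^{k_j} ∂_0 ρ expresses it through ∂_0. -/
theorem IsRootBranch.partialD_powerSum_zero (hU : IsOpen U) (hk0 : k 0 = 0)
    (h : IsRootBranch k U ρ) {c : ℤ} (hc : c ≠ 0) (j : Fin (m + 2)) :
    Set.EqOn (partialD j (powerSum k ρ 0 c)) (powDeriv ρ (-(c - k j))) U := by
  intro x hx
  rw [powerSum_zero, h.partialD_zpow_div hU (neg_ne_zero.2 hc) hx,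
    h.partialD_eq_pow_mul hU hk0 hx, powDeriv, ← mul_assoc, ← zpow_natCast,
    ← zpow_add₀ (h.ne_zero x hx)]
  congr 2; ring

/-- Formally ∂_j(ρ^s/s) = ∂_0(ρ^{s+k_j}/(s+k_j)), to which ∂_0 is applied. The direct computation
also covers s = 0 and s + k_j = 0, where logarithms would appear. -/
theorem IsRootBranch.partialD_powDeriv (hU : IsOpen U) (hk0 : k 0 = 0)
    (h : IsRootBranch k U ρ) (s : ℤ) (j : Fin (m + 2)) :
    Set.EqOn (partialD j (powDeriv ρ s)) (partialD 0 (powDeriv ρ (s + k j))) U := by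
  intro x hx
  have hρ := h.smooth hU
  have hd := h.differentiableAt hU hx
  have h0 := h.ne_zero x hx
  have hz : ∀ s : ℤ, DifferentiableAt ℂ (fun x => ρ x ^ s) x := fun s =>
    ((h.zpow_smooth hU s).contDiffAt (hU.mem_nhds hx)).differentiableAt (by simp)
  have hp : ∀ i, DifferentiableAt ℂ (partialD i ρ) x := fun i =>
    ((partialD_smooth hU hρ i).contDiffAt (hU.mem_nhds hx)).differentiableAt (by simp)
  have e1 : ∀ (s : ℤ) (i : Fin (m + 2)), partialD i (powDeriv ρ s) x =
      (s - 1) * ρ x ^ (s - 1 - 1) * partialD i ρ x * partialD 0 ρ x +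
        ρ x ^ (s - 1) * partialD i (partialD 0 ρ) x := by
    intro s i
    have h1 := partialD_mul (hz (s - 1)) (hp 0) i
    rw [partialD_zpow hd h0] at h1
    push_cast at h1
    exact h1
  have e2 : partialD j (partialD 0 ρ) x =
      k j * ρ x ^ (k j - 1) * partialD 0 ρ x * partialD 0 ρ x +
        ρ x ^ k j * partialD 0 (partialD 0 ρ) x := by
    rw [partialD_comm hU hρ j 0 hx,
      partialD_congr hU (fun y hy => h.partialD_eq_pow_mul hU hk0 hy j) 0 hx]
    have h1 := partialD_mul (hd.pow (k j)) (hp 0) 0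
    change partialD 0 ((ρ ^ k j) * partialD 0 ρ) x = _
    rw [h1]
    have h2 := partialD_pow hd (k j) 0
    change partialD 0 (ρ ^ k j) x = _ at h2
    rw [h2]
    simp
  have e3 : (k j : ℂ) * ρ x ^ (k j - 1) = k j * ρ x ^ k j * (ρ x)⁻¹ := by
    rcases Nat.eq_zero_or_pos (k j) with hj | hj
    · simp [hj]
    · have : ρ x ^ k j = ρ x ^ (k j - 1) * ρ x := by rw [← pow_succ]; congr 1; omega
      rw [this]; field_simp
  rw [e1, e1, e2, e3, h.partialD_eq_pow_mul hU hk0 hx]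
  have z1 : ρ x ^ (s - 1 - 1) = ρ x ^ (s - 1) * (ρ x)⁻¹ := by
    rw [zpow_sub_one₀ h0]
  have z2 : ρ x ^ (s + k j - 1 - 1) = ρ x ^ (s - 1) * (ρ x)⁻¹ * ρ x ^ k j := by
    rw [← z1, ← zpow_natCast, ← zpow_add₀ h0]; congr 1; ring
  have z3 : ρ x ^ (s + k j - 1) = ρ x ^ (s - 1) * ρ x ^ k j := by
    rw [← zpow_natCast, ← zpow_add₀ h0]; congr 1; ring
  rw [z1, z2, z3]
  push_cast
  ring

/-- The function `ψ_ρ(β)`, given by explicit formulas for all `β ∉ I(A)`. -/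
def rootFun (k : Fin (m + 2) → ℕ) (ρ : (Fin (m + 2) → ℂ) → ℂ) (β : Fin 2 → ℤ) :
    (Fin (m + 2) → ℂ) → ℂ :=
  if 0 ≤ β 0 then powerSum k ρ (β 0).toNat (β 1)
  else (partialD 0)^[(-β 0 - 1).toNat] (powDeriv ρ (-β 1))

theorem IsRootBranch.rootFun_smooth (hU : IsOpen U) (h : IsRootBranch k U ρ) (β : Fin 2 → ℤ) :
    ContDiffOn ℂ ∞ (rootFun k ρ β) U := by
  unfold rootFun
  split_ifs
  · exact h.powerSum_smooth hU _ _
  · exact iterate_partialD_smooth hU (h.powDeriv_smooth hU _) 0 _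

/-- The contiguity relation behind everything else. The three cases glue the formulas of `rootFun`
across β_0 = 0; since `powDeriv` is already a first derivative, β_0 = -1 corresponds to no further
∂_0. -/
theorem IsRootBranch.partialD_rootFun (hU : IsOpen U) (hk0 : k 0 = 0) (h : IsRootBranch k U ρ)
    {β : Fin 2 → ℤ} (hβ : β ∉ semigroupI k) (j : Fin (m + 2)) :
    Set.EqOn (partialD j (rootFun k ρ β)) (rootFun k ρ (β - deg k (Pi.single j 1))) U := by
  have e0 : (β - deg k (Pi.single j 1)) 0 = β 0 - 1 := by rw [Pi.sub_apply, deg_single_zero]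
  have e1 : (β - deg k (Pi.single j 1)) 1 = β 1 - k j := by rw [Pi.sub_apply, deg_single_one]
  simp only [rootFun, e0, e1]
  rcases lt_trichotomy (β 0) 0 with hb | hb | hb
  · rw [if_neg (by omega), if_neg (by omega)]
    have : (-(β 0 - 1) - 1).toNat = (-β 0 - 1).toNat + 1 := by omega
    rw [this, Function.iterate_succ_apply]
    refine (partialD_iterate_comm hU (h.powDeriv_smooth hU _) j 0 _).trans
      (iterate_partialD_congr hU ?_ 0 _)
    have h2 : -(β 1 - (k j : ℤ)) = -β 1 + k j := by ring
    rw [h2]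
    exact h.partialD_powDeriv hU hk0 _ j
  · rw [if_pos (by omega), if_neg (by omega), hb]
    have hc : β 1 ≠ 0 := by
      intro hc
      refine hβ ⟨0, ?_⟩
      rw [deg_zero]
      funext i
      fin_cases i
      · exact hb.symm
      · exact hc.symm
    exact h.partialD_powerSum_zero hU hk0 hc j
  · rw [if_pos hb.le, if_pos (by omega)]
    have : (β 0).toNat = (β 0 - 1).toNat + 1 := by omega
    rw [this]
    refine h.partialD_powerSum hU _ _ (fun u hu => ?_) j
    rw [← this] at hu
    exact weight_ne hb.le hβ hu

theorem IsRootBranch.iterD_rootFun (hU : IsOpen U) (hk0 : k 0 = 0) (h : IsRootBranch k U ρ)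
    {β : Fin 2 → ℤ} (hβ : β ∉ semigroupI k) (u : Fin (m + 2) → ℕ) :
    Set.EqOn (iterD u (rootFun k ρ β)) (rootFun k ρ (β - deg k u)) U := by
  induction u using multiIndex_induction with
  | h0 => rw [iterD_zero, deg_zero, sub_zero]; exact fun _ _ => rfl
  | hs u j ih =>
    refine (iterD_add_single hU (h.rootFun_smooth hU β) u j).trans
      ((partialD_congr hU ih j).trans ?_)
    rw [deg_add, ← sub_sub]
    exact h.partialD_rootFun hU hk0 (sub_deg_notMem k hβ u) j

/-- Since `rootFun` does not involve u, all admissible shifts define the same function. -/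
theorem IsRootBranch.psi_eqOn_rootFun (hU : IsOpen U) (hk : StrictMono k) (hk0 : k 0 = 0)
    (h : IsRootBranch k U ρ) {α : Fin 2 → ℤ} {u : Fin (m + 2) → ℕ} (hu : IsAdmissible k α u) :
    Set.EqOn (psi k ρ α u) (rootFun k ρ α) U := by
  have h1 : psiNonneg k ρ (α + deg k u) = rootFun k ρ (α + deg k u) := by
    rw [psiNonneg_eq_powerSum hk ρ hu.1 hu.2, rootFun, if_pos hu.1]
  rw [psi, h1]
  have := h.iterD_rootFun hU hk0 hu.2 u
  rwa [add_sub_cancel_right] at this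

/-- The `i`-th Euler equation with eigenvalue `c`. -/
def IsEulerOn (k : Fin (m + 2) → ℕ) (U : Set (Fin (m + 2) → ℂ)) (i : Fin 2) (c : ℂ)
    (φ : (Fin (m + 2) → ℂ) → ℂ) : Prop :=
  ∀ x ∈ U, ∑ j, (curveMatrix k i j : ℂ) * x j * partialD j φ x = c * φ x

/-- The commutator of ∂_l with the i-th Euler operator is A_{il} ∂_l, so ∂_l lowers the eigenvalue
by A_{il}. -/
theorem IsEulerOn.partialD (hU : IsOpen U) {i : Fin 2} {c : ℂ} {φ : (Fin (m + 2) → ℂ) → ℂ}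
    (hφ : ContDiffOn ℂ ∞ φ U) (h : IsEulerOn k U i c φ) (l : Fin (m + 2)) :
    IsEulerOn k U i (c - curveMatrix k i l) (partialD l φ) := by
  intro x hx
  have hd : ∀ {g : (Fin (m + 2) → ℂ) → ℂ}, ContDiffOn ℂ ∞ g U → DifferentiableAt ℂ g x :=
    fun hg => (hg.contDiffAt (hU.mem_nhds hx)).differentiableAt (by simp)
  have hp := fun j => partialD_smooth hU hφ j
  have e := partialD_congr hU (g := fun x => ∑ j, (curveMatrix k i j : ℂ) * x j *
    MonomialCurve.partialD j φ x) (h := fun x => c * φ x) h l hx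
  have hc : ∀ j, ContDiffOn ℂ ∞ (fun x : Fin (m + 2) → ℂ => (curveMatrix k i j : ℂ) * x j) U :=
    fun j => by fun_prop
  rw [partialD_sum Finset.univ (g := fun j x => (curveMatrix k i j : ℂ) * x j *
    MonomialCurve.partialD j φ x) (fun j _ => hd ((hc j).mul (hp j)))] at e
  have e1 : ∀ j, MonomialCurve.partialD l (fun x => (curveMatrix k i j : ℂ) * x j *
      MonomialCurve.partialD j φ x) x = (curveMatrix k i j : ℂ) * (if j = l then 1 else 0) *
        MonomialCurve.partialD j φ x + (curveMatrix k i j : ℂ) * x j *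
          MonomialCurve.partialD j (MonomialCurve.partialD l φ) x := by
    intro j
    have h1 := partialD_mul (hd (hc j)) (hd (hp j)) l
    have h2 := partialD_mul (differentiableAt_const (x := x) (curveMatrix k i j : ℂ))
      (show DifferentiableAt ℂ (fun x : Fin (m + 2) → ℂ => x j) x by fun_prop) l
    rw [partialD_const, partialD_coord, zero_mul, zero_add] at h2
    rw [← partialD_comm hU hφ l j hx, ← h2]
    exact h1
  have e2 : MonomialCurve.partialD l (fun x => c * φ x) x = c * MonomialCurve.partialD l φ x := by
    have h2 := partialD_mul (differentiableAt_const (x := x) c) (hd hφ) l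
    rw [partialD_const, zero_mul, zero_add] at h2
    exact h2
  rw [e2] at e
  simp only [e1, Finset.sum_add_distrib, mul_ite, mul_one, mul_zero, ite_mul, zero_mul,
    Finset.sum_ite_eq', Finset.mem_univ, if_true] at e
  linear_combination e

theorem IsEulerOn.congr (hU : IsOpen U) {i : Fin 2} {c : ℂ} {φ χ : (Fin (m + 2) → ℂ) → ℂ}
    (hφ : IsEulerOn k U i c φ) (h : Set.EqOn χ φ U) : IsEulerOn k U i c χ := by
  intro x hx
  rw [h hx, ← hφ x hx]
  exact Finset.sum_congr rfl fun j _ => by rw [partialD_congr hU h j hx]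

theorem IsEulerOn.iterD (hU : IsOpen U) {i : Fin 2} {c : ℂ} {φ : (Fin (m + 2) → ℂ) → ℂ}
    (hφ : ContDiffOn ℂ ∞ φ U) (h : IsEulerOn k U i c φ) (u : Fin (m + 2) → ℕ) :
    IsEulerOn k U i (c - deg k u i) (iterD u φ) := by
  induction u using multiIndex_induction with
  | h0 => simpa [iterD_zero, deg_zero] using h
  | hs u j ih =>
    have h1 := (ih.partialD hU (iterD_smooth hU hφ u) j).congr hU (iterD_add_single hU hφ u j)
    have h2 : deg k (Pi.single j 1) i = curveMatrix k i j := by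
      fin_cases i
      · simp only [Fin.zero_eta]; rw [deg_single_zero]; simp [curveMatrix]
      · simp only [Fin.mk_one]; rw [deg_single_one]; simp [curveMatrix]
    rw [deg_add, Pi.add_apply, h2]
    push_cast
    rwa [← sub_sub]

/-- If ρ has weight b under the operator ∑ a_j x_j ∂_j, then each term x^u/u! · ρ^s/s is an
eigenfunction with eigenvalue ∑ a_j u_j + b s; the last hypothesis makes these eigenvalues agree.
The two rows of A use b = 0 and b = -1. -/
theorem IsRootBranch.sum_mul_partialD_powerSum (hU : IsOpen U) (h : IsRootBranch k U ρ) (r : ℕ)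
    (c : ℤ) (hc : ∀ u ∈ Finset.univ.piAntidiag r, (weight k u : ℤ) - c ≠ 0)
    (a : Fin (m + 2) → ℂ) (b e : ℂ) {x : Fin (m + 2) → ℂ} (hx : x ∈ U)
    (hb : ∑ j, a j * x j * partialD j ρ x = b * ρ x)
    (he : ∀ u ∈ Finset.univ.piAntidiag r,
      ∑ j, a j * u j + b * (((weight k u : ℤ) - c : ℤ) : ℂ) = e) :
    ∑ j, a j * x j * partialD j (powerSum k ρ r c) x = e * powerSum k ρ r c x := by
  simp only [h.partialD_powerSum_aux hU r c hc hx, Finset.mul_sum, powerSum]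
  rw [Finset.sum_comm]
  refine Finset.sum_congr rfl fun u hu => ?_
  rw [← he u hu]
  set s : ℤ := (weight k u : ℤ) - c with hs
  have hs0 : (s : ℂ) ≠ 0 := by exact_mod_cast hc u hu
  have h0 := h.ne_zero x hx
  have e1 : ∀ j, a j * x j * (partialD j (divMonomial u) x * (ρ x ^ s / (s : ℂ)) +
      divMonomial u x * (ρ x ^ (s - 1) * partialD j ρ x)) =
      (a j * u j) * (divMonomial u x * (ρ x ^ s / (s : ℂ))) +
        (a j * x j * partialD j ρ x) * (divMonomial u x * ρ x ^ (s - 1)) := by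
    intro j
    linear_combination a j * (ρ x ^ s / (s : ℂ)) * mul_partialD_divMonomial u j x
  simp only [e1, Finset.sum_add_distrib, ← Finset.sum_mul, hb]
  rw [zpow_sub_one₀ h0]
  field_simp

theorem IsRootBranch.powerSum_isEulerOn (hU : IsOpen U) (h : IsRootBranch k U ρ) (r : ℕ)
    (c : ℤ) (hc : ∀ u ∈ Finset.univ.piAntidiag r, (weight k u : ℤ) - c ≠ 0) :
    IsEulerOn k U 0 r (powerSum k ρ r c) ∧ IsEulerOn k U 1 c (powerSum k ρ r c) := by
  constructor
  · intro x hx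
    refine h.sum_mul_partialD_powerSum hU r c hc (fun j => (curveMatrix k 0 j : ℂ)) 0 r hx ?_ ?_
    · simpa [curveMatrix] using h.sum_mul_partialD hU hx
    · intro u hu
      have hs : ∑ j, u j = r := by simpa using hu
      simp [curveMatrix, ← hs]
  · intro x hx
    refine h.sum_mul_partialD_powerSum hU r c hc (fun j => (curveMatrix k 1 j : ℂ)) (-1) c hx ?_ ?_
    · simpa [curveMatrix] using h.sum_mul_mul_partialD hU hx
    · intro u hu
      simp [curveMatrix, weight]

theorem IsRootBranch.psi_isHypergeometricOn (hU : IsOpen U) (hk : StrictMono k) (hk0 : k 0 = 0)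
    (h : IsRootBranch k U ρ) {α : Fin 2 → ℤ} (hα : α ∉ semigroupI k) {u : Fin (m + 2) → ℕ}
    (hu : IsAdmissible k α u) : IsHypergeometricOn k α U (psi k ρ α u) := by
  have hpsi := h.psi_eqOn_rootFun hU hk hk0 hu
  refine ⟨((h.rootFun_smooth hU α).congr hpsi).differentiableOn (by simp), ?_, ?_⟩
  · intro v hv x hx
    have key : ∀ w, iterD w (psi k ρ α u) x = rootFun k ρ (α - deg k w) x := fun w =>
      ((iterD_congr hU hpsi w).trans (h.iterD_rootFun hU hk0 hα w)) hx
    rw [key, key]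
    -- A v = 0 says A v⁺ = A v⁻, and the derivative depends only on this vector.
    have : deg k (fun j => (v j).toNat) = deg k (fun j => (-v j).toNat) := by
      rw [← sub_eq_zero, deg, deg, ← Matrix.mulVec_sub, ← hv]
      congr 1
      funext j
      simp only [Pi.sub_apply]
      omega
    rw [this]
  -- The Euler equations hold at α + A u and descend to α through D_u.
  · have h1 := psiNonneg_eq_powerSum hk ρ hu.1 hu.2
    have h2 := h.powerSum_isEulerOn hU _ ((α + deg k u) 1) (fun v hv => weight_ne hu.1 hu.2 hv)
    have hsm := h.powerSum_smooth hU ((α + deg k u) 0).toNat ((α + deg k u) 1)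
    have h3 : (((α + deg k u) 0).toNat : ℂ) = ((α + deg k u) 0 : ℤ) := by
      have := Int.toNat_of_nonneg hu.1
      exact_mod_cast this
    rw [h3] at h2
    have key : ∀ i, IsEulerOn k U i ((α + deg k u) i : ℤ)
        (powerSum k ρ ((α + deg k u) 0).toNat ((α + deg k u) 1)) := by
      intro i
      fin_cases i
      · exact h2.1
      · exact h2.2
    intro i
    have := (key i).iterD hU hsm u
    rw [psi, h1]
    have h4 : (((α + deg k u) i : ℤ) : ℂ) - deg k u i = α i := by
      rw [Pi.add_apply]; push_cast; ring
    rw [h4] at this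
    exact this

end Branch

end Solutions

/-! ### Linear relations under a doubly transitive Galois group -/

section Galois

/-- If the linear relation `∑ cⱼ γⱼ = 0` is stable under a doubly transitive permutation group and
its coefficients are not all equal, then all `γⱼ` are equal. -/
theorem eq_of_relation_of_doublyTransitive {ι L : Type*} [Fintype ι] [DecidableEq ι] [Field L]
    [CharZero L] (H : Subgroup (Equiv.Perm ι))
    (h2 : ∀ a b a' b', a ≠ b → a' ≠ b' → ∃ π ∈ H, π a = a' ∧ π b = b') (c γ : ι → L)
    (hrel : ∀ π ∈ H, ∑ j, c j * γ (π j) = 0) {a b : ι} (hab : c a ≠ c b) (i i' : ι) :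
    γ i = γ i' := by
  classical
  have hne : a ≠ b := fun h => hab (by rw [h])
  have hcard : (Fintype.card ι : L) ≠ 0 := by
    have : 0 < Fintype.card ι := Fintype.card_pos_iff.2 ⟨a⟩
    exact_mod_cast this.ne'
  suffices h : ∀ i, (Fintype.card ι : L) * γ i = ∑ j, γ j from
    mul_left_cancel₀ hcard ((h i).trans (h i').symm)
  clear i i'
  intro i
  -- Fix i and sum the relation over the coset S a of all π in H with π a = i. Double transitivity
  -- makes the inner sums T γ a j independent of j ≠ a, and of a.
  let S : ι → Finset (Equiv.Perm ι) := fun a => Finset.univ.filter fun π => π ∈ H ∧ π a = i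
  have hS : ∀ {a π}, π ∈ S a ↔ π ∈ H ∧ π a = i := by simp [S]
  let T : (ι → L) → ι → ι → L := fun g a j => ∑ π ∈ S a, g (π j)
  have hT : ∀ g, ∀ τ ∈ H, ∀ a j, T g a j = T g (τ a) (τ j) := by
    intro g τ hτ a j
    refine Finset.sum_bij' (fun π _ => π * τ⁻¹) (fun π _ => π * τ) ?_ ?_ ?_ ?_ ?_
    · intro π hπ
      rw [hS] at hπ ⊢
      exact ⟨H.mul_mem hπ.1 (H.inv_mem hτ), by simp [hπ.2]⟩
    · intro π hπ
      rw [hS] at hπ ⊢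
      exact ⟨H.mul_mem hπ.1 hτ, by simp [hπ.2]⟩
    · intro π _; simp
    · intro π _; simp
    · intro π _; simp
  set t := T γ a b with ht
  have hTt : ∀ a' b', a' ≠ b' → T γ a' b' = t := by
    intro a' b' h
    obtain ⟨τ, hτ, rfl, rfl⟩ := h2 a b a' b' hne h
    exact (hT γ τ hτ a b).symm
  set N : L := ((S a).card : L) with hN
  have hNb : ((S b).card : L) = N := by
    obtain ⟨τ, hτ, h1, -⟩ := h2 a b b a hne hne.symm
    -- For the constant function 1, T counts the coset.
    have := hT (fun _ => 1) τ hτ a a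
    simp only [T, Finset.sum_const, nsmul_eq_mul, mul_one, h1] at this
    exact this.symm
  have hN0 : N ≠ 0 := by
    have : (S a).Nonempty := by
      by_cases hai : a = i
      · exact ⟨1, hS.2 ⟨H.one_mem, by simp [hai]⟩⟩
      · obtain ⟨τ, hτ, h1, -⟩ := h2 a i i a hai (Ne.symm hai)
        exact ⟨τ, hS.2 ⟨hτ, h1⟩⟩
    rw [hN]
    exact_mod_cast this.card_pos.ne'
  have hself : ∀ a, T γ a a = (S a).card * γ i := by
    intro a
    rw [← nsmul_eq_mul, ← Finset.sum_const]
    exact Finset.sum_congr rfl fun π hπ => by rw [(hS.1 hπ).2]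
  have hsum : ∑ j, T γ a j = N * ∑ j, γ j := by
    simp only [T]
    rw [Finset.sum_comm, hN, ← nsmul_eq_mul, ← Finset.sum_const]
    exact Finset.sum_congr rfl fun π _ => Equiv.sum_comp π γ
  have hrelT : ∀ a, ∑ j, c j * T γ a j = 0 := by
    intro a
    simp only [T, Finset.mul_sum]
    rw [Finset.sum_comm]
    exact Finset.sum_eq_zero fun π hπ => hrel π (hS.1 hπ).1
  have hsplit : ∀ (a : ι) (g : ι → L), ∑ j, g j * T γ a j =
      g a * T γ a a + (∑ j, g j - g a) * t := by
    intro a g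
    rw [← Finset.add_sum_erase _ _ (Finset.mem_univ a),
      ← Finset.add_sum_erase _ g (Finset.mem_univ a), add_sub_cancel_left, Finset.sum_mul]
    congr 1
    exact Finset.sum_congr rfl fun j hj => by rw [hTt a j (Finset.ne_of_mem_erase hj).symm]
  have ea := hrelT a
  have eb := hrelT b
  rw [hsplit, hself] at ea eb
  rw [hNb] at eb
  -- The summed relation reads c_a N γ_i + (∑ c - c_a) t = 0, and likewise for b; subtracting leaves
  -- (c_a - c_b)(N γ_i - t) = 0.
  have et : N * γ i - t = 0 := by
    have : (c a - c b) * (N * γ i - t) = 0 := by linear_combination ea - eb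
    exact (mul_eq_zero.1 this).resolve_left (sub_ne_zero.2 hab)
  -- Summing T γ a j over j gives N ∑ γ = N γ_i + (card - 1) t, and t = N γ_i, so γ_i is the mean of
  -- all γ_j.
  have e1 := hsplit a (fun _ => 1)
  simp only [one_mul, hsum, hself, Finset.sum_const, Finset.card_univ, nsmul_eq_mul, mul_one] at e1
  refine mul_left_cancel₀ hN0 ?_
  rw [e1]
  linear_combination ((Fintype.card ι : L) - 1) * et

/-- View E as a subfield of L through f; by normality g extends from E to all of L. -/
theorem exists_algEquiv_extending {K E L : Type*} [Field K] [Field E] [Field L] [Algebra K E]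
    [Algebra K L] [Normal K L] (f g : E →ₐ[K] L) : ∃ σ : L ≃ₐ[K] L, ∀ x, σ (f x) = g x := by
  let _ : Algebra E L := f.toRingHom.toAlgebra
  have : IsScalarTower K E L := IsScalarTower.of_algebraMap_eq' f.comp_algebraMap.symm
  let σ : L →ₐ[K] L :=
    @AlgHom.liftNormal K _ E L _ _ _ _ g L _ _ _ (Algebra.id L) _ _ _
  have hσ : ∀ x, σ (f x) = g x := fun x =>
    @AlgHom.liftNormal_commutes K _ E L _ _ _ _ g L _ _ _ (Algebra.id L) _ _ _ x
  exact ⟨AlgEquiv.ofBijective σ (Algebra.IsAlgebraic.algHom_bijective σ), hσ⟩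

theorem roots_eq_map_of_injective {F : Type*} [Field F] {d : ℕ} {p : F[X]} (hp : p ≠ 0)
    (hd : p.natDegree = d) {r : Fin d → F} (hr : Function.Injective r)
    (hroot : ∀ i, p.IsRoot (r i)) : p.roots = Finset.univ.val.map r := by
  symm
  refine Multiset.eq_of_le_of_card_le ?_ ?_
  · rw [Multiset.le_iff_subset (Multiset.Nodup.map hr Finset.univ.nodup)]
    intro z hz
    obtain ⟨i, -, rfl⟩ := Multiset.mem_map.1 hz
    exact (mem_roots hp).2 (hroot i)
  · simpa [hd] using p.card_roots'

theorem eq_C_mul_prod_of_injective {F : Type*} [Field F] {d : ℕ} {p : F[X]} (hp : p ≠ 0)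
    (hd : p.natDegree = d) {r : Fin d → F} (hr : Function.Injective r)
    (hroot : ∀ i, p.IsRoot (r i)) : p = C p.leadingCoeff * ∏ i, (X - C (r i)) := by
  have h1 := roots_eq_map_of_injective hp hd hr hroot
  have h2 : p.roots.card = p.natDegree := by rw [h1]; simp [hd]
  conv_lhs => rw [← C_leadingCoeff_mul_prod_multiset_X_sub_C h2, h1]
  rw [Multiset.map_map]
  rfl

/-- Families `(φ₁, …, φ_d)` of elements of `M` of the form `φⱼ = G(ρⱼ)` for a rational function `G`
with coefficients in `K`. -/
inductive IsRationalFamily (K : Type*) {M : Type*} [Field K] [Field M] [Algebra K M] {d : ℕ}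
    (ρ : Fin d → M) : (Fin d → M) → Prop
  | const (a : K) : IsRationalFamily K ρ fun _ => algebraMap K M a
  | root : IsRationalFamily K ρ ρ
  | inv {φ : Fin d → M} : IsRationalFamily K ρ φ → IsRationalFamily K ρ fun j => (φ j)⁻¹
  | add {φ χ : Fin d → M} : IsRationalFamily K ρ φ → IsRationalFamily K ρ χ →
      IsRationalFamily K ρ fun j => φ j + χ j
  | mul {φ χ : Fin d → M} : IsRationalFamily K ρ φ → IsRationalFamily K ρ χ →
      IsRationalFamily K ρ fun j => φ j * χ j

/-- Automorphisms over K commute with rational operations over K, so they permute the values G(ρ_j)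
exactly as they permute the roots. -/
theorem IsRationalFamily.exists_equivariant {K M : Type*} [Field K] [Field M] [Algebra K M] {d : ℕ}
    {ρ φ : Fin d → M} (h : IsRationalFamily K ρ φ) (L : IntermediateField K M) (r : Fin d → L)
    (hr : ∀ j, (r j : M) = ρ j) :
    ∃ γ : Fin d → L, (∀ j, (γ j : M) = φ j) ∧
      ∀ (σ : L ≃ₐ[K] L) (i j : Fin d), σ (r i) = r j → σ (γ i) = γ j := by
  induction h with
  | const a => exact ⟨fun _ => algebraMap K L a, fun _ => rfl, fun σ _ _ _ => σ.commutes a⟩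
  | root => exact ⟨r, hr, fun σ i j h => h⟩
  | inv _ ih =>
    obtain ⟨γ, h1, h2⟩ := ih
    exact ⟨fun j => (γ j)⁻¹, fun j => by simp [h1], fun σ i j h => by rw [map_inv₀, h2 σ i j h]⟩
  | add _ _ ih ih' =>
    obtain ⟨γ, h1, h2⟩ := ih
    obtain ⟨γ', h1', h2'⟩ := ih'
    exact ⟨fun j => γ j + γ' j, fun j => by simp [h1, h1'],
      fun σ i j h => by rw [map_add, h2 σ i j h, h2' σ i j h]⟩
  | mul _ _ ih ih' =>
    obtain ⟨γ, h1, h2⟩ := ih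
    obtain ⟨γ', h1', h2'⟩ := ih'
    exact ⟨fun j => γ j * γ' j, fun j => by simp [h1, h1'],
      fun σ i j h => by rw [map_mul, h2 σ i j h, h2' σ i j h]⟩

open IntermediateField in
-- Work in the splitting field L of p. The hypothesis `hiso`, extended to automorphisms of L, makes
-- the Galois group doubly transitive on the roots; a relation with coefficients in K is stable
-- under it.
theorem IsRationalFamily.eq_of_relation {K M : Type*} [Field K] [Field M] [Algebra K M]
    [CharZero M] {d : ℕ}
    {ρ : Fin d → M} (hinj : Function.Injective ρ) {p : K[X]} (hp : p ≠ 0) (hd : p.natDegree = d)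
    (hroot : ∀ i, aeval (ρ i) p = 0)
    (hiso : ∀ a b a' b', a ≠ b → a' ≠ b' → ∃ f : adjoin K {ρ a, ρ b} →ₐ[K] M,
      f ⟨ρ a, subset_adjoin K _ (by simp)⟩ = ρ a' ∧ f ⟨ρ b, subset_adjoin K _ (by simp)⟩ = ρ b')
    {φ : Fin d → M} (hφ : IsRationalFamily K ρ φ) (c : Fin d → K)
    (hrel : ∑ j, algebraMap K M (c j) * φ j = 0) {a b : Fin d} (hab : c a ≠ c b) (i j : Fin d) :
    φ i = φ j := by
  classical
  have hmap0 : p.map (algebraMap K M) ≠ 0 := (Polynomial.map_ne_zero_iff (algebraMap K M).injective).2 hp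
  have hfac := eq_C_mul_prod_of_injective hmap0 (by rw [natDegree_map, hd]) hinj
    (fun i => by rw [IsRoot, eval_map_algebraMap]; exact hroot i)
  have hsplits : (p.map (algebraMap K M)).Splits := by
    rw [hfac]
    exact (Splits.C _).mul (Splits.prod fun i _ => Splits.X_sub_C _)
  have hrange : ∀ z : M, aeval z p = 0 → ∃ i, z = ρ i := by
    intro z hz
    rw [← eval_map_algebraMap, hfac, eval_mul, eval_C, eval_prod] at hz
    have := (mul_eq_zero.1 hz).resolve_left (leadingCoeff_ne_zero.2 hmap0)
    obtain ⟨i, -, hi⟩ := Finset.prod_eq_zero_iff.1 this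
    exact ⟨i, by simpa [sub_eq_zero] using hi⟩
  let L : IntermediateField K M := adjoin K (p.rootSet M)
  have : p.IsSplittingField K L := adjoin_rootSet_isSplittingField hsplits
  have : Normal K L := Normal.of_isSplittingField p
  have hmem : ∀ i, ρ i ∈ L := fun i => subset_adjoin K _ ((mem_rootSet_of_ne hp).2 (hroot i))
  let r : Fin d → L := fun i => ⟨ρ i, hmem i⟩
  have hrinj : Function.Injective r := fun i j h => hinj (congrArg Subtype.val h)
  obtain ⟨γ, hγ, heq⟩ := hφ.exists_equivariant L r (fun _ => rfl)
  -- The Galois group as a permutation group of the roots.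
  let H : Subgroup (Equiv.Perm (Fin d)) :=
    { carrier := {π | ∃ σ : L ≃ₐ[K] L, ∀ i, σ (r i) = r (π i)}
      one_mem' := ⟨1, fun i => rfl⟩
      mul_mem' := by
        rintro π π' ⟨σ, hσ⟩ ⟨σ', hσ'⟩
        exact ⟨σ * σ', fun i => by rw [AlgEquiv.mul_apply, hσ', hσ]; rfl⟩
      inv_mem' := by
        rintro π ⟨σ, hσ⟩
        refine ⟨σ⁻¹, fun i => ?_⟩
        have := hσ (π⁻¹ i)
        rw [show π (π⁻¹ i) = i from π.apply_symm_apply i] at this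
        rw [← this]
        exact σ.symm_apply_apply _ }
  have hperm : ∀ σ : L ≃ₐ[K] L, ∃ π ∈ H, ∀ i, σ (r i) = r (π i) := by
    intro σ
    have h1 : ∀ i, ∃ j, σ (r i) = r j := by
      intro i
      have h2 : aeval ((σ (r i) : L) : M) p = 0 := by
        have h3 : aeval (r i) p = 0 := by
          apply Subtype.val_injective
          have := aeval_algebraMap_apply M (r i) p
          rw [show algebraMap L M (r i) = ρ i from rfl, hroot] at this
          exact this.symm
        have h4 : aeval (σ (r i)) p = 0 := by
          rw [aeval_algHom_apply σ, h3, map_zero]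
        have h5 := aeval_algebraMap_apply M (σ (r i)) p
        rw [h4, map_zero] at h5
        exact h5
      obtain ⟨j, hj⟩ := hrange _ h2
      exact ⟨j, Subtype.ext hj⟩
    choose π hπ using h1
    have hπi : Function.Injective π := fun i j h => hrinj (σ.injective (by rw [hπ, hπ, h]))
    exact ⟨Equiv.ofBijective π (Finite.injective_iff_bijective.1 hπi), ⟨σ, hπ⟩, hπ⟩
  have h2 : ∀ a b a' b', a ≠ b → a' ≠ b' → ∃ π ∈ H, π a = a' ∧ π b = b' := by
    intro a b a' b' h h'
    obtain ⟨f, hfa, hfb⟩ := hiso a b a' b' h h'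
    have hle : adjoin K {ρ a, ρ b} ≤ L := by
      rw [adjoin_le_iff]
      rintro z (rfl | rfl)
      · exact hmem a
      · exact hmem b
    -- The image of f stays in L because the generators go to roots.
    have hf : ∀ z : adjoin K {ρ a, ρ b}, f z ∈ L := by
      rintro ⟨z, hz⟩
      induction hz using adjoin_induction with
      | mem z hz =>
        rcases hz with rfl | rfl
        · rw [hfa]; exact hmem _
        · rw [hfb]; exact hmem _
      | algebraMap z =>
        have := f.commutes z
        exact (congrArg (· ∈ L) this).mpr (L.algebraMap_mem z)
      | add x y hx hy ihx ihy =>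
        have := map_add f ⟨x, hx⟩ ⟨y, hy⟩
        exact this ▸ L.add_mem ihx ihy
      | inv x hx ih =>
        have := map_inv₀ f ⟨x, hx⟩
        exact this ▸ L.inv_mem ih
      | mul x y hx hy ihx ihy =>
        have := map_mul f ⟨x, hx⟩ ⟨y, hy⟩
        exact this ▸ L.mul_mem ihx ihy
    obtain ⟨σ, hσ⟩ := exists_algEquiv_extending (inclusion hle)
      (f.codRestrict L.toSubalgebra hf : adjoin K {ρ a, ρ b} →ₐ[K] L)
    obtain ⟨π, hπ, hσπ⟩ := hperm σ
    refine ⟨π, hπ, hrinj ?_, hrinj ?_⟩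
    · rw [← hσπ]
      exact (hσ ⟨ρ a, _⟩).trans (Subtype.ext hfa)
    · rw [← hσπ]
      exact (hσ ⟨ρ b, _⟩).trans (Subtype.ext hfb)
  have hrel' : ∑ j, algebraMap K L (c j) * γ j = 0 := by
    apply Subtype.val_injective
    have : (((∑ j, algebraMap K L (c j) * γ j : L)) : M) = ∑ j, algebraMap K M (c j) * φ j := by
      push_cast
      exact Finset.sum_congr rfl fun j _ => by rw [hγ]
    rw [this, hrel, ZeroMemClass.coe_zero]
  have hkey := eq_of_relation_of_doublyTransitive H h2 (fun j => algebraMap K L (c j)) γ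
    (by
      rintro π ⟨σ, hσ⟩
      have := congrArg σ hrel'
      rw [map_sum, map_zero] at this
      rw [← this]
      refine Finset.sum_congr rfl fun j _ => ?_
      rw [map_mul, σ.commutes, heq σ j (π j) (hσ j)])
    (a := a) (b := b) (fun h => hab ((algebraMap K L).injective h)) i j
  rw [← hγ, ← hγ, hkey]

end Galois

/-! ### Double transitivity: any two pairs of roots are conjugate -/

section Isomorphism

/-- The two equations are linear in x_0 and x_1; as k_0 = 0, their difference does not involve x_0.
-/
theorem sum_two_roots {m : ℕ} {R : Type*} [CommRing R] {k : Fin (m + 2) → ℕ} (hk0 : k 0 = 0)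
    {x : Fin (m + 2) → R} {s t : R} (hs : ∑ l, x l * s ^ k l = 0) (ht : ∑ l, x l * t ^ k l = 0) :
    x 1 * (s ^ k 1 - t ^ k 1) =
      -∑ l ∈ (Finset.univ.erase 0).erase 1, x l * (s ^ k l - t ^ k l) ∧
    x 0 = -∑ l ∈ Finset.univ.erase 0, x l * s ^ k l := by
  have h1 : (1 : Fin (m + 2)) ∈ (Finset.univ.erase 0 : Finset (Fin (m + 2))) := by simp
  constructor
  · have : ∑ l, x l * (s ^ k l - t ^ k l) = 0 := by
      simp only [mul_sub, Finset.sum_sub_distrib, hs, ht, sub_zero]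
    rw [← Finset.add_sum_erase _ _ (Finset.mem_univ 0), ← Finset.add_sum_erase _ _ h1, hk0] at this
    linear_combination this
  · rw [← Finset.add_sum_erase _ _ (Finset.mem_univ 0), hk0] at hs
    linear_combination hs

/-- The family `x` with `x₀`, `x₁` replaced by `s`, `t`. -/
def replacePair {m : ℕ} {M : Type*} (x : Fin (m + 2) → M) (s t : M) : Fin (m + 2) → M :=
  Function.update (Function.update x 1 t) 0 s

theorem replacePair_zero {m : ℕ} {M : Type*} (x : Fin (m + 2) → M) (s t : M) :
    replacePair x s t 0 = s := by simp [replacePair]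

theorem replacePair_one {m : ℕ} {M : Type*} (x : Fin (m + 2) → M) (s t : M) :
    replacePair x s t 1 = t := by simp [replacePair]

theorem replacePair_of_ne {m : ℕ} {M : Type*} (x : Fin (m + 2) → M) (s t : M) {l : Fin (m + 2)}
    (h0 : l ≠ 0) (h1 : l ≠ 1) : replacePair x s t l = x l := by simp [replacePair, h0, h1]

open IntermediateField
open scoped IntermediateField.algebraAdjoinAdjoin

variable {m : ℕ} {M : Type*} [Field M] [Algebra ℂ M] {k : Fin (m + 2) → ℕ} {x : Fin (m + 2) → M}

theorem mem_adjoin_replacePair (hk0 : k 0 = 0) {s t : M} (hs : ∑ l, x l * s ^ k l = 0)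
    (ht : ∑ l, x l * t ^ k l = 0) (hst : s ^ k 1 ≠ t ^ k 1) (l : Fin (m + 2)) :
    x l ∈ adjoin ℂ (Set.range (replacePair x s t)) := by
  set E := adjoin ℂ (Set.range (replacePair x s t))
  have hmem : ∀ l, replacePair x s t l ∈ E := fun l => subset_adjoin ℂ _ ⟨l, rfl⟩
  have hsE : s ∈ E := by simpa [replacePair_zero] using hmem 0
  have htE : t ∈ E := by simpa [replacePair_one] using hmem 1
  have h2 : ∀ l, l ≠ 0 → l ≠ 1 → x l ∈ E := fun l h0 h1 => by
    simpa [replacePair_of_ne x s t h0 h1] using hmem l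
  obtain ⟨e1, e0⟩ := sum_two_roots hk0 hs ht
  have hx1 : x 1 ∈ E := by
    rw [eq_div_of_mul_eq (sub_ne_zero.2 hst) e1]
    refine E.div_mem (E.neg_mem (E.sum_mem fun l hl => ?_))
      (E.sub_mem (pow_mem hsE _) (pow_mem htE _))
    simp only [Finset.mem_erase, Finset.mem_univ, and_true] at hl
    exact E.mul_mem (h2 l hl.2 hl.1) (E.sub_mem (pow_mem hsE _) (pow_mem htE _))
  have h1 : ∀ l, l ≠ 0 → x l ∈ E := fun l h0 => by
    by_cases h : l = 1
    · rwa [h]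
    · exact h2 l h0 h
  by_cases h0 : l = 0
  · rw [h0, e0]
    refine E.neg_mem (E.sum_mem fun l hl => ?_)
    exact E.mul_mem (h1 l (Finset.ne_of_mem_erase hl)) (pow_mem hsE _)
  · exact h1 l h0

/-- A family of `n` elements over which `n` algebraically independent elements are rational is
algebraically independent. -/
theorem algebraicIndependent_of_mem_adjoin {n : ℕ} {x y : Fin n → M} (hx : AlgebraicIndependent ℂ x)
    (h : ∀ l, x l ∈ adjoin ℂ (Set.range y)) : AlgebraicIndependent ℂ y := by
  let E := adjoin ℂ (Set.range y)
  let y' : Fin n → E := fun l => ⟨y l, subset_adjoin ℂ _ ⟨l, rfl⟩⟩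
  let x' : Fin n → E := fun l => ⟨x l, h l⟩
  have hx' : AlgebraicIndependent ℂ x' := AlgebraicIndependent.of_comp E.val hx
  -- The field generated by the n elements y has transcendence degree at least n, so y must be a
  -- transcendence basis.
  have hcard := hx'.lift_cardinalMk_le_trdeg
  have htop : adjoin ℂ (Set.range y') = ⊤ := by
    apply IntermediateField.map_injective E.val
    rw [adjoin_map, ← AlgHom.fieldRange_eq_map, fieldRange_val, ← Set.range_comp]
    rfl
  have halg : Algebra.IsAlgebraic (Algebra.adjoin ℂ (Set.range y')) E := by
    refine ⟨fun z => ?_⟩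
    have hz : z ∈ adjoin ℂ (Set.range y') := htop ▸ IntermediateField.mem_top
    have := Algebra.IsAlgebraic.isAlgebraic (R := Algebra.adjoin ℂ (Set.range y'))
      (⟨z, hz⟩ : adjoin ℂ (Set.range y'))
    exact this.algebraMap
  have := Algebra.IsAlgebraic.isTranscendenceBasis_of_lift_le_trdeg_of_finite ℂ y' hcard
  exact this.1.map' (f := E.val) E.val.injective

/-- Both (s, t, x_2, …) and (s', t', x_2, …) are algebraically independent, so there is an embedding
Φ sending the first to the second. It fixes x_0 and x_1, since these are the same rational
expressions in either family; it is therefore ℂ(x)-linear on ℂ(x)(s, t). -/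
theorem exists_algHom_adjoin_pair (hx : AlgebraicIndependent ℂ x) (hk0 : k 0 = 0) {s t s' t' : M}
    (hs : ∑ l, x l * s ^ k l = 0) (ht : ∑ l, x l * t ^ k l = 0)
    (hs' : ∑ l, x l * s' ^ k l = 0) (ht' : ∑ l, x l * t' ^ k l = 0)
    (hst : s ^ k 1 ≠ t ^ k 1) (hst' : s' ^ k 1 ≠ t' ^ k 1) :
    ∃ f : adjoin (adjoin ℂ (Set.range x)) {s, t} →ₐ[adjoin ℂ (Set.range x)] M,
      f ⟨s, subset_adjoin _ _ (by simp)⟩ = s' ∧ f ⟨t, subset_adjoin _ _ (by simp)⟩ = t' := by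
  have hxE := mem_adjoin_replacePair hk0 hs ht hst
  have hy := algebraicIndependent_of_mem_adjoin hx hxE
  have hy' := algebraicIndependent_of_mem_adjoin hx (mem_adjoin_replacePair hk0 hs' ht' hst')
  set y := replacePair x s t with hydef
  set y' := replacePair x s' t' with hydef'
  set E := adjoin ℂ (Set.range y) with hE
  let Φ : E →ₐ[ℂ] M := ((adjoin ℂ (Set.range y')).val.comp hy'.aevalEquivField.toAlgHom).comp
    hy.aevalEquivField.symm.toAlgHom
  have hyE : ∀ l, y l ∈ E := fun l => subset_adjoin ℂ _ ⟨l, rfl⟩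
  have hΦ : ∀ l, Φ ⟨y l, hyE l⟩ = y' l := by
    intro l
    have h1 : hy.aevalEquivField (algebraMap (MvPolynomial (Fin (m + 2)) ℂ) _ (MvPolynomial.X l)) = ⟨y l, hyE l⟩ := by
      apply Subtype.ext
      rw [AlgebraicIndependent.aevalEquivField_algebraMap_apply_coe, MvPolynomial.aeval_X]
    change ((hy'.aevalEquivField (hy.aevalEquivField.symm ⟨y l, hyE l⟩) : _) : M) = y' l
    rw [← h1, AlgEquiv.symm_apply_apply, AlgebraicIndependent.aevalEquivField_algebraMap_apply_coe,
      MvPolynomial.aeval_X]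
  have hsE : s ∈ E := by simpa [hydef, replacePair_zero] using hyE 0
  have htE : t ∈ E := by simpa [hydef, replacePair_one] using hyE 1
  have hΦs : Φ ⟨s, hsE⟩ = s' := by
    have := hΦ 0
    simpa only [hydef, hydef', replacePair_zero] using this
  have hΦt : Φ ⟨t, htE⟩ = t' := by
    have := hΦ 1
    simpa only [hydef, hydef', replacePair_one] using this
  have h2 : ∀ l, l ≠ 0 → l ≠ 1 → Φ ⟨x l, hxE l⟩ = x l := by
    intro l h0 h1
    have := hΦ l
    simpa only [hydef, hydef', replacePair_of_ne _ _ _ h0 h1] using this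
  obtain ⟨e1, e0⟩ := sum_two_roots (x := fun l => (⟨x l, hxE l⟩ : E)) (s := ⟨s, hsE⟩)
    (t := ⟨t, htE⟩) hk0 (Subtype.ext (by simpa using hs)) (Subtype.ext (by simpa using ht))
  obtain ⟨e1', e0'⟩ := sum_two_roots hk0 hs' ht'
  replace e1 := congrArg Φ e1
  replace e0 := congrArg Φ e0
  simp only [map_mul, map_sub, map_pow, map_neg, map_sum, hΦs, hΦt] at e1 e0
  have hx1 : Φ ⟨x 1, hxE 1⟩ = x 1 := by
    refine mul_right_cancel₀ (sub_ne_zero.2 hst') ?_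
    rw [e1, e1']
    congr 1
    refine Finset.sum_congr rfl fun l hl => ?_
    simp only [Finset.mem_erase, Finset.mem_univ, and_true] at hl
    rw [h2 l hl.2 hl.1]
  have h1 : ∀ l, l ≠ 0 → Φ ⟨x l, hxE l⟩ = x l := fun l h0 => by
    by_cases h : l = 1
    · subst h; exact hx1
    · exact h2 l h0 h
  have hxl : ∀ l, Φ ⟨x l, hxE l⟩ = x l := by
    intro l
    by_cases h0 : l = 0
    · subst h0
      rw [e0, e0']
      congr 1
      exact Finset.sum_congr rfl fun l hl => by rw [h1 l (Finset.ne_of_mem_erase hl)]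
    · exact h1 l h0
  have hKE : adjoin ℂ (Set.range x) ≤ E := by
    rw [adjoin_le_iff]
    rintro _ ⟨l, rfl⟩
    exact hxE l
  have hK : Φ.comp (inclusion hKE) = (adjoin ℂ (Set.range x)).val := by
    refine algHom_ext_of_eq_adjoin _ rfl ?_
    rintro _ ⟨l, rfl⟩
    exact hxl l
  have hle : ∀ z ∈ adjoin (adjoin ℂ (Set.range x)) {s, t}, z ∈ E := by
    have : adjoin (adjoin ℂ (Set.range x)) {s, t} ≤ extendScalars hKE := by
      rw [adjoin_le_iff]
      rintro z (rfl | rfl)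
      · exact hsE
      · exact htE
    exact this
  refine ⟨{ toFun := fun z => Φ ⟨z, hle z z.2⟩
            map_one' := Φ.map_one
            map_mul' := fun a b => Φ.map_mul ⟨a, hle a a.2⟩ ⟨b, hle b b.2⟩
            map_zero' := Φ.map_zero
            map_add' := fun a b => Φ.map_add ⟨a, hle a a.2⟩ ⟨b, hle b b.2⟩
            commutes' := fun a => DFunLike.congr_fun hK a }, hΦs, hΦt⟩

end Isomorphism

/-! ### Functions rational in x and a root -/

section RationalInRoot

variable {n d : ℕ}

/-- Families `(φ₁, …, φ_d)` of functions of the form `φⱼ(x) = G(x, ρⱼ(x))` on `U` for a rational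
function `G`. -/
inductive IsRationalFamilyOn (U : Set (Fin n → ℂ)) (ρ : Fin d → (Fin n → ℂ) → ℂ) :
    (Fin d → (Fin n → ℂ) → ℂ) → Prop
  | const (c : ℂ) : IsRationalFamilyOn U ρ fun _ _ => c
  | coord (l : Fin n) : IsRationalFamilyOn U ρ fun _ x => x l
  | root : IsRationalFamilyOn U ρ ρ
  | inv {φ : Fin d → (Fin n → ℂ) → ℂ} : (∀ j, ∀ x ∈ U, φ j x ≠ 0) → IsRationalFamilyOn U ρ φ →
      IsRationalFamilyOn U ρ fun j x => (φ j x)⁻¹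
  | add {φ χ : Fin d → (Fin n → ℂ) → ℂ} : IsRationalFamilyOn U ρ φ → IsRationalFamilyOn U ρ χ →
      IsRationalFamilyOn U ρ fun j x => φ j x + χ j x
  | mul {φ χ : Fin d → (Fin n → ℂ) → ℂ} : IsRationalFamilyOn U ρ φ → IsRationalFamilyOn U ρ χ →
      IsRationalFamilyOn U ρ fun j x => φ j x * χ j x
  | congr {φ χ : Fin d → (Fin n → ℂ) → ℂ} : (∀ j, Set.EqOn (χ j) (φ j) U) →
      IsRationalFamilyOn U ρ φ → IsRationalFamilyOn U ρ χ

namespace IsRationalFamilyOn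

variable {U : Set (Fin n → ℂ)} {ρ φ : Fin d → (Fin n → ℂ) → ℂ}

theorem smooth (hρ : ∀ j, ContDiffOn ℂ ∞ (ρ j) U) (h : IsRationalFamilyOn U ρ φ) (j : Fin d) :
    ContDiffOn ℂ ∞ (φ j) U := by
  induction h with
  | const c => exact contDiffOn_const
  | coord l => fun_prop
  | root => exact hρ j
  | inv h0 _ ih => exact ih.inv (h0 j)
  | add _ _ ih ih' => exact ih.add ih'
  | mul _ _ ih ih' => exact ih.mul ih'
  | congr h0 _ ih => exact ih.congr (h0 j)

theorem pow (h : IsRationalFamilyOn U ρ φ) (r : ℕ) :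
    IsRationalFamilyOn U ρ fun j x => φ j x ^ r := by
  induction r with
  | zero => simpa using const 1
  | succ r ih => simpa only [pow_succ] using ih.mul h

theorem zpow (h0 : ∀ j, ∀ x ∈ U, φ j x ≠ 0) (h : IsRationalFamilyOn U ρ φ) (s : ℤ) :
    IsRationalFamilyOn U ρ fun j x => φ j x ^ s := by
  rcases Int.le_total 0 s with hs | hs
  · lift s to ℕ using hs
    simpa using h.pow s
  · obtain ⟨t, rfl⟩ : ∃ t : ℕ, s = -t := ⟨(-s).toNat, by omega⟩
    simp only [zpow_neg, zpow_natCast]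
    exact inv (fun j x hx => pow_ne_zero _ (h0 j x hx)) (h.pow t)

theorem sum {ι : Type*} (s : Finset ι) {g : ι → Fin d → (Fin n → ℂ) → ℂ}
    (h : ∀ i ∈ s, IsRationalFamilyOn U ρ (g i)) :
    IsRationalFamilyOn U ρ fun j x => ∑ i ∈ s, g i j x := by
  classical
  induction s using Finset.induction_on with
  | empty => simpa using const 0
  | insert a s ha ih =>
    simp only [Finset.sum_insert ha]
    exact (h a (by simp)).add (ih fun i hi => h i (by simp [hi]))

theorem prod {ι : Type*} (s : Finset ι) {g : ι → Fin d → (Fin n → ℂ) → ℂ}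
    (h : ∀ i ∈ s, IsRationalFamilyOn U ρ (g i)) :
    IsRationalFamilyOn U ρ fun j x => ∏ i ∈ s, g i j x := by
  classical
  induction s using Finset.induction_on with
  | empty => simpa using const 1
  | insert a s ha ih =>
    simp only [Finset.prod_insert ha]
    exact (h a (by simp)).mul (ih fun i hi => h i (by simp [hi]))

theorem neg (h : IsRationalFamilyOn U ρ φ) : IsRationalFamilyOn U ρ fun j x => -φ j x := by
  simpa using (const (-1)).mul h

theorem div_const (h : IsRationalFamilyOn U ρ φ) (c : ℂ) :
    IsRationalFamilyOn U ρ fun j x => φ j x / c := by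
  simpa only [div_eq_mul_inv] using h.mul (const c⁻¹)

end IsRationalFamilyOn

end RationalInRoot

/-! ### Stability under differentiation, and distinctness of the k_1-th powers -/

section Families

variable {m d : ℕ} {k : Fin (m + 2) → ℕ} {U : Set (Fin (m + 2) → ℂ)}
  {ρ φ : Fin d → (Fin (m + 2) → ℂ) → ℂ}

open IsRationalFamilyOn

/-- Closure holds because ∂_l ρ is itself rational in x and ρ, by the same formula for every root.
-/
theorem IsRationalFamilyOn.partialD (hU : IsOpen U) (hρ : ∀ j, IsRootBranch k U (ρ j))
    (h : IsRationalFamilyOn U ρ φ) (l : Fin (m + 2)) :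
    IsRationalFamilyOn U ρ fun j => MonomialCurve.partialD l (φ j) := by
  have hd : ∀ {χ : Fin d → (Fin (m + 2) → ℂ) → ℂ}, IsRationalFamilyOn U ρ χ → ∀ j, ∀ x ∈ U,
      DifferentiableAt ℂ (χ j) x := fun h j x hx =>
    ((h.smooth (fun j => (hρ j).smooth hU) j).contDiffAt (hU.mem_nhds hx)).differentiableAt
      (by simp)
  induction h with
  | const c => exact congr (fun _ x _ => partialD_const c x l) (const 0)
  | coord i => exact congr (fun _ x _ => partialD_coord i l x) (const _)
  | root =>
    refine congr (fun j x hx => (hρ j).partialD_eq hU hx l) ((root.pow _).neg.mul (inv ?_ ?_))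
    · exact fun j x hx => (hρ j).deriv_ne_zero x hx
    · exact IsRationalFamilyOn.sum Finset.univ
        fun i _ => (coord i).mul ((const (k i : ℂ)).mul (root.pow (k i - 1)))
  | inv h0 h ih =>
    exact congr (fun j x hx => partialD_inv (hd h j x hx) (h0 j x hx) l)
      (ih.neg.mul ((inv h0 h).mul (inv h0 h)))
  | add h h' ih ih' =>
    exact congr (fun j x hx => partialD_add (hd h j x hx) (hd h' j x hx) l) (ih.add ih')
  | mul h h' ih ih' =>
    exact congr (fun j x hx => partialD_mul (hd h j x hx) (hd h' j x hx) l)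
      ((ih.mul h').add (h.mul ih'))
  | congr h0 _ ih => exact congr (fun j => partialD_congr hU (h0 j) l) ih

theorem IsRationalFamilyOn.rootFun (hU : IsOpen U) (hρ : ∀ j, IsRootBranch k U (ρ j))
    (β : Fin 2 → ℤ) : IsRationalFamilyOn U ρ fun j => MonomialCurve.rootFun k (ρ j) β := by
  have hz := fun s : ℤ => root.zpow (fun j x hx => (hρ j).ne_zero x hx) s
  unfold MonomialCurve.rootFun
  split_ifs
  · exact IsRationalFamilyOn.sum _ fun u _ =>
      (IsRationalFamilyOn.prod _ fun j _ => ((coord j).pow (u j)).div_const _).mul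
        ((hz _).div_const _)
  · have h : ∀ r s, IsRationalFamilyOn U ρ fun j =>
        (MonomialCurve.partialD 0)^[r] (powDeriv (ρ j) s) := by
      intro r s
      induction r with
      | zero => exact (hz _).mul (root.partialD hU hρ 0)
      | succ r ih =>
        simp only [Function.iterate_succ_apply']
        exact ih.partialD hU hρ 0
    exact h _ _

/-- Differentiate r^{k_1} = s^{k_1} in x_l and in x_0 and compare, using ∂_l = ρ^{k_l} ∂_0 on roots:
r^{k_l} = s^{k_l} for all l. So the order of r/s divides the gcd of the exponents, which is 1. -/
theorem IsRootBranch.eqOn_of_pow_eq (hU : IsOpen U) (hk : StrictMono k) (hk0 : k 0 = 0)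
    (hgcd : Finset.univ.gcd k = 1) {r s : (Fin (m + 2) → ℂ) → ℂ} (hr : IsRootBranch k U r)
    (hs : IsRootBranch k U s) (h : ∀ x ∈ U, r x ^ k 1 = s x ^ k 1) : Set.EqOn r s U := by
  intro x hx
  have hk1 : k 1 ≠ 0 := by
    have : k 0 < k 1 := hk (by simp)
    omega
  have e : ∀ l, r x ^ (k 1 - 1) * partialD l r x = s x ^ (k 1 - 1) * partialD l s x := by
    intro l
    have := partialD_congr hU h l hx
    rw [partialD_pow (hr.differentiableAt hU hx), partialD_pow (hs.differentiableAt hU hx),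
      mul_assoc, mul_assoc] at this
    exact mul_left_cancel₀ (by exact_mod_cast hk1) this
  have hr0 := hr.ne_zero x hx
  have hs0 := hs.ne_zero x hx
  have e2 : ∀ l, r x ^ k l = s x ^ k l := by
    intro l
    have h1 := e l
    rw [hr.partialD_eq_pow_mul hU hk0 hx, hs.partialD_eq_pow_mul hU hk0 hx, mul_left_comm,
      e 0, mul_left_comm (s x ^ (k 1 - 1))] at h1
    exact mul_right_cancel₀ (mul_ne_zero (pow_ne_zero _ hs0)
      (hs.partialD_ne_zero hU hx 0)) h1
  have e3 : orderOf (r x / s x) ∣ Finset.univ.gcd k := Finset.dvd_gcd fun l _ =>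
    orderOf_dvd_of_pow_eq_one (by rw [div_pow, e2, div_self (pow_ne_zero _ hs0)])
  rw [hgcd, Nat.dvd_one, orderOf_eq_one_iff, div_eq_one_iff_eq hs0] at e3
  exact e3

end Families

/-! ### The domain of holomorphic functions on a convex set -/

section HolomorphicRing

variable {n : ℕ}

/-- The algebra of holomorphic functions on `B`. -/
def holomorphicAlgebra (B : Set (Fin n → ℂ)) : Subalgebra ℂ (B → ℂ) where
  carrier := {g | ∃ F : (Fin n → ℂ) → ℂ, DifferentiableOn ℂ F B ∧ ∀ x : B, g x = F x}
  mul_mem' := by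
    rintro _ _ ⟨F, hF, h⟩ ⟨F', hF', h'⟩
    exact ⟨F * F', hF.mul hF', fun x => by simp [h, h']⟩
  add_mem' := by
    rintro _ _ ⟨F, hF, h⟩ ⟨F', hF', h'⟩
    exact ⟨F + F', hF.add hF', fun x => by simp [h, h']⟩
  algebraMap_mem' c := ⟨fun _ => c, differentiableOn_const c, fun _ => rfl⟩

/-- A function holomorphic on `B` as an element of the algebra. -/
def holomorphicAlgebra.mk {B : Set (Fin n → ℂ)} (F : (Fin n → ℂ) → ℂ)
    (hF : DifferentiableOn ℂ F B) : holomorphicAlgebra B :=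
  ⟨fun x => F x, F, hF, fun _ => rfl⟩

/-- The one-variable identity theorem on the complex line through y and z, whose intersection with B
is convex, hence connected. -/
theorem eq_zero_of_eventually_eq_zero {B : Set (Fin n → ℂ)} (hB : IsOpen B) (hc : Convex ℝ B)
    {F : (Fin n → ℂ) → ℂ} (hF : DifferentiableOn ℂ F B) {y : Fin n → ℂ} (hy : y ∈ B)
    (h : ∀ᶠ x in 𝓝 y, F x = 0) {z : Fin n → ℂ} (hz : z ∈ B) : F z = 0 := by
  let L : ℂ → (Fin n → ℂ) := fun t => t • (z - y) + y
  have hLd : Differentiable ℂ L := by fun_prop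
  have hV : IsOpen (L ⁻¹' B) := hB.preimage hLd.continuous
  have hVc : Convex ℝ (L ⁻¹' B) := by
    intro p hp q hq s t hs ht hst
    have hst' : (s : ℂ) + t = 1 := by exact_mod_cast hst
    have : L (s • p + t • q) = s • L p + t • L q := by
      funext i
      simp only [L, Pi.add_apply, Pi.smul_apply, Pi.sub_apply, smul_eq_mul, Complex.real_smul]
      linear_combination (-y i) * hst'
    rw [Set.mem_preimage, this]
    exact hc hp hq hs ht hst
  have hg : DifferentiableOn ℂ (F ∘ L) (L ⁻¹' B) :=
    hF.comp hLd.differentiableOn fun _ h => h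
  have h0 : L 0 = y := by simp [L]
  have h1 : L 1 = z := by simp [L]
  have hev : (F ∘ L) =ᶠ[𝓝 0] 0 := by
    have : Filter.Tendsto L (𝓝 0) (𝓝 y) := by
      have := hLd.continuous.tendsto 0
      rwa [h0] at this
    exact this.eventually h
  have := (hg.analyticOnNhd hV).eqOn_zero_of_preconnected_of_eventuallyEq_zero
    hVc.isPreconnected (show (0 : ℂ) ∈ L ⁻¹' B by simpa [h0] using hy) hev
    (show (1 : ℂ) ∈ L ⁻¹' B by simpa [h1] using hz)
  simpa [h1] using this

theorem holomorphicAlgebra.isDomain {B : Set (Fin n → ℂ)} (hB : IsOpen B) (hc : Convex ℝ B)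
    (hne : B.Nonempty) : IsDomain (holomorphicAlgebra B) := by
  obtain ⟨y, hy⟩ := hne
  have : Nontrivial (holomorphicAlgebra B) := ⟨0, 1, fun h => by
    have := congrFun (congrArg Subtype.val h) ⟨y, hy⟩
    simp at this⟩
  have : NoZeroDivisors (holomorphicAlgebra B) := by
    refine ⟨?_⟩
    rintro ⟨f, F, hF, hf⟩ ⟨g, G, hG, hg⟩ hfg
    by_contra! hcon
    obtain ⟨x, hx⟩ : ∃ x, f x ≠ 0 := by
      by_contra! h
      exact hcon.1 (Subtype.ext (funext h))
    refine hcon.2 (Subtype.ext (funext fun z => ?_))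
    change g z = 0
    rw [hg]
    refine eq_zero_of_eventually_eq_zero hB hc hG x.2 ?_ z.2
    have hFc : ContinuousAt F x := (hF.continuousOn).continuousAt (hB.mem_nhds x.2)
    rw [hf] at hx
    filter_upwards [hFc.eventually_ne hx, hB.mem_nhds x.2] with w hw hwB
    have := congrFun (congrArg Subtype.val hfg) ⟨w, hwB⟩
    change f ⟨w, hwB⟩ * g ⟨w, hwB⟩ = 0 at this
    rw [hf, hg] at this
    exact (mul_eq_zero.1 this).resolve_left hw
  exact NoZeroDivisors.to_isDomain _

/-- A polynomial vanishing on a product of infinite sets, here a polydisc, is zero. -/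
theorem holomorphicAlgebra.algebraicIndependent_coord {B : Set (Fin n → ℂ)} (hB : IsOpen B)
    (hne : B.Nonempty) : AlgebraicIndependent ℂ fun l : Fin n =>
      (holomorphicAlgebra.mk (fun x => x l) (by fun_prop) : holomorphicAlgebra B) := by
  rw [algebraicIndependent_iff]
  intro p hp
  obtain ⟨y, hy⟩ := hne
  obtain ⟨ε, hε, hball⟩ := Metric.isOpen_iff.1 hB y hy
  refine MvPolynomial.funext_set (s := fun i => Metric.ball (y i) ε) (fun i => ?_) fun x hx => ?_
  · exact infinite_of_mem_nhds (y i) (Metric.ball_mem_nhds _ hε)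
  · have hxB : x ∈ B := hball (by rwa [← ball_pi y hε] at hx)
    let ev : holomorphicAlgebra B →ₐ[ℂ] ℂ :=
      (Pi.evalAlgHom ℂ (fun _ : B => ℂ) ⟨x, hxB⟩).comp (holomorphicAlgebra B).val
    have h2 := congrArg ev hp
    rw [map_zero, MvPolynomial.comp_aeval_apply] at h2
    rw [map_zero, ← h2, ← MvPolynomial.coe_aeval_eq_eval]
    rfl

end HolomorphicRing

/-! ### Sparse polynomials over a ring -/

section SparsePolynomial

variable {m : ℕ} {R : Type*} [CommRing R]

/-- The polynomial `∑ⱼ aⱼ t^{kⱼ}`. -/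
def sparsePoly (k : Fin (m + 2) → ℕ) (a : Fin (m + 2) → R) : R[X] := ∑ j, C (a j) * X ^ k j

theorem sparsePoly_coeff {k : Fin (m + 2) → ℕ} (hk : StrictMono k) (a : Fin (m + 2) → R)
    (j : Fin (m + 2)) : (sparsePoly k a).coeff (k j) = a j := by
  simp only [sparsePoly, finsetSum_coeff, coeff_C_mul_X_pow, hk.injective.eq_iff]
  simp

theorem sparsePoly_natDegree {k : Fin (m + 2) → ℕ} (hk : StrictMono k) {a : Fin (m + 2) → R}
    (ha : a (Fin.last (m + 1)) ≠ 0) : (sparsePoly k a).natDegree = k (Fin.last (m + 1)) := by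
  refine natDegree_eq_of_le_of_coeff_ne_zero ?_ (by rwa [sparsePoly_coeff hk])
  exact natDegree_sum_le_of_forall_le _ _ fun j _ =>
    (natDegree_C_mul_X_pow_le _ _).trans (hk.monotone (Fin.le_last j))

theorem sparsePoly_aeval {A : Type*} [CommRing A] [Algebra R A] (k : Fin (m + 2) → ℕ)
    (a : Fin (m + 2) → R) (t : A) :
    aeval t (sparsePoly k a) = ∑ j, algebraMap R A (a j) * t ^ k j := by
  simp [sparsePoly]

theorem sparsePoly_eval (k : Fin (m + 2) → ℕ) (a : Fin (m + 2) → R) (t : R) :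
    (sparsePoly k a).eval t = ∑ j, a j * t ^ k j := by
  simp [sparsePoly, eval_finsetSum]

end SparsePolynomial

/-! ### From analytic relations to field theory -/

section Relation

variable {m d : ℕ} {k : Fin (m + 2) → ℕ}

open IntermediateField

/-- Translates families of functions into families in the field M. For inverses, nonvanishing on B
makes 1/φ_j holomorphic, so that ι sends it to the field inverse. -/
theorem IsRationalFamilyOn.exists_isRationalFamily {B : Set (Fin (m + 2) → ℂ)}
    {ρ φ : Fin d → (Fin (m + 2) → ℂ) → ℂ} (hφ : IsRationalFamilyOn B ρ φ)
    {K M : Type*} [Field K] [Field M] [Algebra K M] [Algebra ℂ K]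
    (ι : holomorphicAlgebra B →+* M) (r : Fin d → holomorphicAlgebra B)
    (hr : ∀ j x, (r j).1 x = ρ j x) (a : Fin (m + 2) → K)
    (hc : ∀ c, algebraMap K M (algebraMap ℂ K c) = ι (algebraMap ℂ _ c))
    (ha : ∀ l, algebraMap K M (a l) = ι (holomorphicAlgebra.mk (fun x => x l) (by fun_prop))) :
    ∃ Φ : Fin d → holomorphicAlgebra B, (∀ j x, (Φ j).1 x = φ j x) ∧
      IsRationalFamily K (fun j => ι (r j)) (fun j => ι (Φ j)) := by
  induction hφ with
  | const c =>
    refine ⟨fun _ => algebraMap ℂ _ c, fun _ _ => rfl, ?_⟩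
    simp only [← hc]
    exact .const _
  | coord l =>
    refine ⟨fun _ => holomorphicAlgebra.mk (fun x => x l) (by fun_prop), fun _ _ => rfl, ?_⟩
    simp only [← ha]
    exact .const _
  | root => exact ⟨r, hr, .root⟩
  | @inv φ h0 _ ih =>
    obtain ⟨Φ, h1, h2⟩ := ih
    have hex : ∀ j, ∃ F, DifferentiableOn ℂ F B ∧ ∀ x : B, (Φ j).1 x = F x := fun j => (Φ j).2
    choose F hF hFe using hex
    have hF0 : ∀ j, ∀ x ∈ B, F j x ≠ 0 := fun j x hx => by
      have := h0 j x hx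
      rwa [← h1 j ⟨x, hx⟩, hFe] at this
    have hprod : ∀ j, holomorphicAlgebra.mk (fun x => (F j x)⁻¹) ((hF j).inv (hF0 j)) * Φ j = 1 := by
      intro j
      apply Subtype.ext
      funext x
      change (F j x)⁻¹ * (Φ j).1 x = 1
      rw [hFe]
      exact inv_mul_cancel₀ (hF0 j x x.2)
    refine ⟨fun j => holomorphicAlgebra.mk (fun x => (F j x)⁻¹) ((hF j).inv (hF0 j)), ?_, ?_⟩
    · intro j x
      change (F j x)⁻¹ = _
      rw [← hFe, h1]
    · have h3 : ∀ j, ι (holomorphicAlgebra.mk (fun x => (F j x)⁻¹) ((hF j).inv (hF0 j))) =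
          (ι (Φ j))⁻¹ := by
        intro j
        refine eq_inv_of_mul_eq_one_left ?_
        rw [← map_mul, hprod, map_one]
      simp only [h3]
      exact h2.inv
  | add _ _ ih ih' =>
    obtain ⟨Φ, h1, h2⟩ := ih
    obtain ⟨Φ', h1', h2'⟩ := ih'
    refine ⟨fun j => Φ j + Φ' j, fun j x => ?_, ?_⟩
    · exact congrArg₂ (· + ·) (h1 j x) (h1' j x)
    · simp only [map_add]
      exact h2.add h2'
  | mul _ _ ih ih' =>
    obtain ⟨Φ, h1, h2⟩ := ih
    obtain ⟨Φ', h1', h2'⟩ := ih'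
    refine ⟨fun j => Φ j * Φ' j, fun j x => ?_, ?_⟩
    · exact congrArg₂ (· * ·) (h1 j x) (h1' j x)
    · simp only [map_mul]
      exact h2.mul h2'
  | congr h0 _ ih =>
    obtain ⟨Φ, h1, h2⟩ := ih
    exact ⟨Φ, fun j x => by rw [h1, h0 j x.2], h2⟩

/-- The case K = ℂ(x) and p = f, with double transitivity supplied by `exists_algHom_adjoin_pair`.
-/
theorem IsRationalFamily.eq_of_constant_relation {M : Type*} [Field M] [Algebra ℂ M]
    (hk : StrictMono k) (hk0 : k 0 = 0) (hd : d = k (Fin.last (m + 1))) {x : Fin (m + 2) → M}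
    (hx : AlgebraicIndependent ℂ x) {r : Fin d → M} (hinj : Function.Injective r)
    (hrt : ∀ i, ∑ l, x l * r i ^ k l = 0) (hpow : ∀ i j, i ≠ j → r i ^ k 1 ≠ r j ^ k 1)
    {φ : Fin d → M} (hφ : IsRationalFamily (adjoin ℂ (Set.range x)) r φ) (c : Fin d → ℂ)
    (hrel : ∑ j, algebraMap ℂ M (c j) * φ j = 0) {a b : Fin d} (hab : c a ≠ c b) (i j : Fin d) :
    φ i = φ j := by
  let xK : Fin (m + 2) → adjoin ℂ (Set.range x) := fun l => ⟨x l, subset_adjoin ℂ _ ⟨l, rfl⟩⟩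
  have hxK : xK (Fin.last (m + 1)) ≠ 0 := fun h => hx.ne_zero _ (congrArg Subtype.val h)
  have hdeg := sparsePoly_natDegree hk hxK
  rw [← hd] at hdeg
  have hp : sparsePoly k xK ≠ 0 := by
    intro h
    have := sparsePoly_coeff hk xK (Fin.last (m + 1))
    rw [h, coeff_zero] at this
    exact hxK this.symm
  have : CharZero M := charZero_of_injective_algebraMap (algebraMap ℂ M).injective
  exact hφ.eq_of_relation hinj hp hdeg
    (fun i => by rw [sparsePoly_aeval]; exact hrt i)
    (fun a b a' b' h h' => exists_algHom_adjoin_pair hx hk0 (hrt a) (hrt b) (hrt a') (hrt b')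
      (hpow a b h) (hpow a' b' h')) (fun j => algebraMap ℂ _ (c j)) hrel
    (fun h => hab ((algebraMap ℂ _).injective h)) i j

theorem IsRationalFamilyOn.eqOn_of_relation_of_embedding (hk : StrictMono k) (hk0 : k 0 = 0)
    (hgcd : Finset.univ.gcd k = 1) (hd : d = k (Fin.last (m + 1)))
    {B : Set (Fin (m + 2) → ℂ)} (hB : IsOpen B) (hne : B.Nonempty)
    {ρ φ : Fin d → (Fin (m + 2) → ℂ) → ℂ} (hρ : ∀ j, IsRootBranch k B (ρ j))
    (hdist : ∀ x ∈ B, Function.Injective fun j => ρ j x) (hφ : IsRationalFamilyOn B ρ φ)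
    {M : Type*} [Field M] [Algebra ℂ M] (ι : holomorphicAlgebra B →ₐ[ℂ] M)
    (hι : Function.Injective ι)
    (c : Fin d → ℂ) (hrel : ∀ x ∈ B, ∑ j, c j * φ j x = 0) {a b : Fin d} (hab : c a ≠ c b)
    (i j : Fin d) : Set.EqOn (φ i) (φ j) B := by
  let xO : Fin (m + 2) → holomorphicAlgebra B :=
    fun l => holomorphicAlgebra.mk (fun x => x l) (by fun_prop)
  let r : Fin d → holomorphicAlgebra B := fun j => holomorphicAlgebra.mk (ρ j) (hρ j).diff
  have hx : AlgebraicIndependent ℂ fun l => ι (xO l) :=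
    (holomorphicAlgebra.algebraicIndependent_coord hB hne).map' hι
  have hrt : ∀ i, ∑ l, ι (xO l) * ι (r i) ^ k l = 0 := by
    intro i
    have : ∑ l, xO l * r i ^ k l = 0 := by
      apply Subtype.ext
      funext y
      have h1 := (hρ i).root y y.2
      have h2 : ((∑ l, xO l * r i ^ k l : holomorphicAlgebra B) : B → ℂ) y =
          ∑ l, y.1 l * ρ i y ^ k l := by
        simp [xO, r, holomorphicAlgebra.mk]
      rw [h2, h1]; rfl
    have := congrArg ι this
    simpa only [map_sum, map_mul, map_pow, map_zero] using this
  obtain ⟨y, hy⟩ := hne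
  have hval : ∀ {F G : holomorphicAlgebra B}, ι F = ι G → ∀ x, F.1 x = G.1 x :=
    fun h x => congrFun (congrArg Subtype.val (hι h)) x
  have hinj : Function.Injective fun i => ι (r i) := fun i j h => hdist y hy (hval h ⟨y, hy⟩)
  have hpow : ∀ i j, i ≠ j → ι (r i) ^ k 1 ≠ ι (r j) ^ k 1 := by
    intro i j hij h
    rw [← map_pow, ← map_pow] at h
    refine hij (hdist y hy ((hρ i).eqOn_of_pow_eq hB hk hk0 hgcd (hρ j) (fun x hx => ?_) hy))
    exact hval h ⟨x, hx⟩
  obtain ⟨Φ, hΦ, hfam⟩ := hφ.exists_isRationalFamily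
    (K := adjoin ℂ (Set.range fun l => ι (xO l))) ι.toRingHom r (fun _ _ => rfl)
    (fun l => ⟨ι (xO l), subset_adjoin ℂ _ ⟨l, rfl⟩⟩) (fun c => (ι.commutes c).symm)
    (fun l => rfl)
  have hrelM : ∑ j, algebraMap ℂ M (c j) * ι (Φ j) = 0 := by
    have h1 : ∑ j, algebraMap ℂ _ (c j) * Φ j = 0 := by
      apply Subtype.ext
      funext z
      have h2 : ((∑ j, algebraMap ℂ _ (c j) * Φ j : holomorphicAlgebra B) : B → ℂ) z =
          ∑ j, c j * φ j z := by
        simp only [← hΦ]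
        simp
      rw [h2, hrel z z.2]; rfl
    have h2 := congrArg ι h1
    rw [map_sum, map_zero] at h2
    rw [← h2]
    exact Finset.sum_congr rfl fun j _ => by rw [map_mul, ι.commutes]
  have hfin := IsRationalFamily.eq_of_constant_relation hk hk0 hd hx hinj hrt hpow hfam c hrelM
    hab i j
  intro z hz
  have := hval hfin ⟨z, hz⟩
  rwa [hΦ, hΦ] at this

/-- A linear relation with constant coefficients between the members of a rational family in the
roots has all its coefficients equal, unless all members coincide. -/
theorem IsRationalFamilyOn.eqOn_of_relation (hk : StrictMono k) (hk0 : k 0 = 0)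
    (hgcd : Finset.univ.gcd k = 1) (hd : d = k (Fin.last (m + 1)))
    {B : Set (Fin (m + 2) → ℂ)} (hB : IsOpen B) (hconv : Convex ℝ B) (hne : B.Nonempty)
    {ρ φ : Fin d → (Fin (m + 2) → ℂ) → ℂ} (hρ : ∀ j, IsRootBranch k B (ρ j))
    (hdist : ∀ x ∈ B, Function.Injective fun j => ρ j x) (hφ : IsRationalFamilyOn B ρ φ)
    (c : Fin d → ℂ) (hrel : ∀ x ∈ B, ∑ j, c j * φ j x = 0) {a b : Fin d} (hab : c a ≠ c b)
    (i j : Fin d) : Set.EqOn (φ i) (φ j) B := by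
  have : IsDomain (holomorphicAlgebra B) := holomorphicAlgebra.isDomain hB hconv hne
  exact hφ.eqOn_of_relation_of_embedding hk hk0 hgcd hd hB hne hρ hdist
    (IsScalarTower.toAlgHom ℂ (holomorphicAlgebra B) (FractionRing (holomorphicAlgebra B)))
    (IsFractionRing.injective (holomorphicAlgebra B) (FractionRing (holomorphicAlgebra B)))
    c hrel hab i j

end Relation

/-! ### Power sums as polynomials in elementary symmetric functions -/

section PowerSums

theorem exists_polynomial_powerSum (d s : ℕ) : ∃ W : MvPolynomial (Fin d) ℂ, ∀ r : Fin d → ℂ,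
    ∑ j, r j ^ s = MvPolynomial.aeval
      (fun i : Fin d => (Finset.univ.val.map r).esymm (i + 1)) W := by
  obtain ⟨W, hW⟩ := MvPolynomial.esymmAlgHom_surjective (σ := Fin d) ℂ (n := d) (by simp)
    ⟨MvPolynomial.psum (Fin d) ℂ s, MvPolynomial.psum_isSymmetric _ _ s⟩
  refine ⟨W, fun r => ?_⟩
  have h1 : MvPolynomial.aeval (fun i : Fin d => MvPolynomial.esymm (Fin d) ℂ (i + 1)) W =
      MvPolynomial.psum (Fin d) ℂ s := by
    rw [← MvPolynomial.esymmAlgHom_apply, hW]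
  have h2 := congrArg (MvPolynomial.aeval r) h1
  rw [MvPolynomial.comp_aeval_apply] at h2
  simp only [MvPolynomial.aeval_esymm_eq_multiset_esymm] at h2
  rw [h2]
  simp [MvPolynomial.psum]

theorem exists_derivative_eq (R : ℂ[X]) : ∃ S : ℂ[X], derivative S = R := by
  induction R using Polynomial.induction_on' with
  | add p q hp hq =>
    obtain ⟨P, rfl⟩ := hp
    obtain ⟨Q, rfl⟩ := hq
    exact ⟨P + Q, derivative_add⟩
  | monomial n a =>
    refine ⟨monomial (n + 1) (a / (n + 1)), ?_⟩
    rw [derivative_monomial]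
    have : (n + 1 : ℂ) ≠ 0 := by exact_mod_cast n.succ_ne_zero
    simp [this]

end PowerSums

/-! ### Restriction to lines in the x_0-direction -/

section Line

variable {n : ℕ} {U : Set (Fin (n + 1) → ℂ)}

/-- The point `p` moved by `z` in the direction of the coordinate `x₀`. -/
def shiftZero (p : Fin (n + 1) → ℂ) (z : ℂ) : Fin (n + 1) → ℂ := p + z • Pi.single 0 1

theorem hasDerivAt_shiftZero {g : (Fin (n + 1) → ℂ) → ℂ} {p : Fin (n + 1) → ℂ} {z : ℂ}
    (hg : DifferentiableAt ℂ g (shiftZero p z)) :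
    HasDerivAt (fun z => g (shiftZero p z)) (partialD 0 g (shiftZero p z)) z := by
  have h : HasDerivAt (shiftZero p) (Pi.single 0 1) z := by
    have := ((hasDerivAt_id z).smul_const (Pi.single 0 1 : Fin (n + 1) → ℂ)).const_add p
    rw [one_smul] at this
    exact this
  exact hg.hasFDerivAt.comp_hasDerivAt z h

/-- Integrate r times in x_0: each antiderivative is a polynomial up to a constant, because a disc
is connected. -/
theorem exists_polynomial_of_iterate_partialD_eq_zero (hU : IsOpen U) {p : Fin (n + 1) → ℂ} {ε : ℝ}
    (hε : 0 < ε) (hp : ∀ z ∈ Metric.ball (0 : ℂ) ε, shiftZero p z ∈ U) (r : ℕ)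
    {g : (Fin (n + 1) → ℂ) → ℂ} (hg : ContDiffOn ℂ ∞ g U)
    (h : ∀ x ∈ U, (partialD 0)^[r] g x = 0) :
    ∃ R : ℂ[X], ∀ z ∈ Metric.ball (0 : ℂ) ε, g (shiftZero p z) = R.eval z := by
  induction r generalizing g with
  | zero => exact ⟨0, fun z hz => by simpa using h _ (hp z hz)⟩
  | succ r ih =>
    obtain ⟨R, hR⟩ := ih (partialD_smooth hU hg 0) h
    obtain ⟨S, rfl⟩ := exists_derivative_eq R
    have hd : ∀ z ∈ Metric.ball (0 : ℂ) ε,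
        HasDerivAt (fun z => g (shiftZero p z) - S.eval z) 0 z := by
      intro z hz
      have h1 := hasDerivAt_shiftZero
        ((hg.contDiffAt (hU.mem_nhds (hp z hz))).differentiableAt (by simp))
      rw [hR z hz] at h1
      have h2 := h1.sub (S.hasDerivAt z)
      rw [sub_self] at h2
      exact h2
    refine ⟨S + C (g (shiftZero p 0) - S.eval 0), fun z hz => ?_⟩
    have h0 : (0 : ℂ) ∈ Metric.ball (0 : ℂ) ε := Metric.mem_ball_self hε
    have := Metric.isOpen_ball.is_const_of_deriv_eq_zero (convex_ball (0 : ℂ) ε).isPreconnected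
      (fun z hz => (hd z hz).differentiableAt.differentiableWithinAt)
      (fun z hz => (hd z hz).deriv) hz h0
    rw [eval_add, eval_C, ← this]
    ring

theorem iterate_partialD_sub (hU : IsOpen U) {g h : (Fin (n + 1) → ℂ) → ℂ}
    (hg : ContDiffOn ℂ ∞ g U) (hh : ContDiffOn ℂ ∞ h U) (j : Fin (n + 1)) (r : ℕ) :
    Set.EqOn ((partialD j)^[r] (g - h)) ((partialD j)^[r] g - (partialD j)^[r] h) U := by
  induction r with
  | zero => exact fun _ _ => rfl
  | succ r ih =>
    simp only [Function.iterate_succ_apply']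
    refine (partialD_congr hU ih j).trans fun x hx => ?_
    exact partialD_sub
      (((iterate_partialD_smooth hU hg j r).contDiffAt (hU.mem_nhds hx)).differentiableAt (by simp))
      (((iterate_partialD_smooth hU hh j r).contDiffAt (hU.mem_nhds hx)).differentiableAt (by simp))
      j

end Line

/-! ### The functions of different roots do not all coincide -/

section NotAllEqual

variable {m d : ℕ} {k : Fin (m + 2) → ℕ} {U : Set (Fin (m + 2) → ℂ)}
  {ρ : Fin d → (Fin (m + 2) → ℂ) → ℂ}

/-- If a sparse polynomial has a nonzero intermediate coefficient, then `f(t) = f(0)` for some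
`t ≠ 0`. -/
theorem exists_ne_zero_sparsePoly_eval_eq (hk : StrictMono k) (hm : 1 ≤ m) {p : Fin (m + 2) → ℂ}
    (hk0 : k 0 = 0) (hp1 : p 1 ≠ 0) (hpl : p (Fin.last (m + 1)) ≠ 0) :
    ∃ a : ℂ, a ≠ 0 ∧ (sparsePoly k p).eval a = (sparsePoly k p).eval 0 := by
  by_contra! hcon
  have hk01 : k 0 < k 1 := hk (by simp)
  set q := sparsePoly k (Function.update p 0 0) with hq
  have hqp : q = sparsePoly k p - C (p 0) := by
    rw [hq, sparsePoly, sparsePoly, ← Finset.add_sum_erase _ _ (Finset.mem_univ 0),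
      ← Finset.add_sum_erase Finset.univ (fun j => C (p j) * X ^ k j) (Finset.mem_univ 0), hk0]
    simp only [Function.update_self, map_zero, zero_add, pow_zero, mul_one,
      add_sub_cancel_left]
    exact Finset.sum_congr rfl fun j hj => by
      rw [Function.update_of_ne (Finset.ne_of_mem_erase hj)]
  have he0 : (sparsePoly k p).eval 0 = p 0 := by
    rw [sparsePoly_eval, Finset.sum_eq_single 0]
    · simp [hk0]
    · intro j _ hj
      have : k 0 < k j := hk (Fin.pos_of_ne_zero hj)
      rw [zero_pow (by omega), mul_zero]
    · simp
  have hlast : (Fin.last (m + 1)) ≠ 0 := (Fin.last_pos).ne'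
  have hdeg : q.natDegree = k (Fin.last (m + 1)) :=
    sparsePoly_natDegree hk (by rwa [Function.update_of_ne hlast])
  have hroots : ∀ a ∈ q.roots, a = 0 := by
    intro a ha
    by_contra h
    have := (mem_roots'.1 ha).2
    rw [IsRoot, hqp, eval_sub, eval_C, sub_eq_zero, ← he0] at this
    exact hcon a h this
  -- If f - f(0) has only the root 0, it is a monomial of degree d, against its nonzero coefficient
  -- p_1 at k_1 < d.
  have hrep : q.roots = Multiset.replicate q.roots.card 0 := Multiset.eq_replicate.2 ⟨rfl, hroots⟩
  have hcard : q.roots.card = q.natDegree := splits_iff_card_roots.1 (IsAlgClosed.splits q)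
  have hfac := C_leadingCoeff_mul_prod_multiset_X_sub_C hcard
  rw [hrep, Multiset.map_replicate, Multiset.prod_replicate, hcard, C_0, sub_zero] at hfac
  have hc := sparsePoly_coeff hk (Function.update p 0 0) 1
  rw [← hq, ← hfac, coeff_C_mul_X_pow, hdeg, if_neg, Function.update_of_ne (by simp)] at hc
  · exact hp1 hc.symm
  · have h1 : (1 : Fin (m + 2)) < Fin.last (m + 1) := by
      rw [Fin.lt_def, Fin.val_one, Fin.val_last]
      omega
    exact (hk h1).ne

theorem shiftZero_apply {n : ℕ} (p : Fin (n + 1) → ℂ) (z : ℂ) (j : Fin (n + 1)) :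
    shiftZero p z j = p j + if j = 0 then z else 0 := by
  simp [shiftZero, Pi.single_apply]

/-- Moving x_0 keeps the leading coefficient constant, so by Vieta the elementary symmetric
functions of the roots, and with them the power sums, are polynomials in z. -/
theorem exists_polynomial_sum_pow_shiftZero (hk : StrictMono k) (hd : d = k (Fin.last (m + 1)))
    (hρ : ∀ j, IsRootBranch k U (ρ j)) (hdist : ∀ x ∈ U, Function.Injective fun j => ρ j x)
    {p : Fin (m + 2) → ℂ} (hpl : p (Fin.last (m + 1)) ≠ 0) {V : Set ℂ}
    (hV : ∀ z ∈ V, shiftZero p z ∈ U) (s : ℕ) :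
    ∃ R : ℂ[X], ∀ z ∈ V, ∑ j, ρ j (shiftZero p z) ^ s = R.eval z := by
  obtain ⟨W, hW⟩ := exists_polynomial_powerSum d s
  let a : Fin (m + 2) → ℂ[X] := fun j => C (p j) + if j = 0 then X else 0
  have ha : ∀ z j, (a j).eval z = shiftZero p z j := by
    intro z j
    rw [shiftZero_apply]
    simp only [a, eval_add, eval_C]
    split_ifs <;> simp
  let e : Fin d → ℂ[X] := fun i =>
    C ((p (Fin.last (m + 1)) * (-1) ^ ((i : ℕ) + 1))⁻¹) * (sparsePoly k a).coeff (d - (i + 1))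
  refine ⟨MvPolynomial.aeval e W, fun z hz => ?_⟩
  have hlast : shiftZero p z (Fin.last (m + 1)) = p (Fin.last (m + 1)) := by
    rw [shiftZero_apply, if_neg (Fin.last_pos).ne', add_zero]
  have hdeg := sparsePoly_natDegree hk (a := shiftZero p z) (by rwa [hlast])
  rw [← hd] at hdeg
  have hlead : (sparsePoly k (shiftZero p z)).leadingCoeff = p (Fin.last (m + 1)) := by
    rw [leadingCoeff, hdeg, hd, sparsePoly_coeff hk, hlast]
  have hne : sparsePoly k (shiftZero p z) ≠ 0 := by
    rw [← leadingCoeff_ne_zero, hlead]; exact hpl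
  have hroots := roots_eq_map_of_injective hne hdeg (hdist _ (hV z hz)) fun i => by
    rw [IsRoot, sparsePoly_eval]
    exact (hρ i).root _ (hV z hz)
  have hcard : (sparsePoly k (shiftZero p z)).roots.card =
      (sparsePoly k (shiftZero p z)).natDegree := by rw [hroots, hdeg]; simp
  have hmap : (sparsePoly k a).map (evalRingHom z) = sparsePoly k (shiftZero p z) := by
    simp only [sparsePoly, Polynomial.map_sum, Polynomial.map_mul, map_C, Polynomial.map_pow, map_X,
      coe_evalRingHom, ha]
  rw [hW, ← coe_aeval_eq_eval, MvPolynomial.comp_aeval_apply]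
  congr 2
  funext i
  have hv := coeff_eq_esymm_roots_of_card hcard (k := d - (i + 1)) (by omega)
  rw [hroots, hdeg, hlead, show d - (d - ((i : ℕ) + 1)) = i + 1 by omega] at hv
  simp only [e, coe_aeval_eq_eval, eval_mul, eval_C]
  have hc : eval z ((sparsePoly k a).coeff (d - (i + 1))) =
      (sparsePoly k (shiftZero p z)).coeff (d - (i + 1)) := by
    rw [← hmap, coeff_map]; rfl
  rw [hc, hv]
  have : p (Fin.last (m + 1)) * (-1) ^ ((i : ℕ) + 1) ≠ 0 :=
    mul_ne_zero hpl (pow_ne_zero _ (by simp))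
  rw [inv_mul_cancel_left₀ this]

theorem powDeriv_eq_partialD (hU : IsOpen U) {r : (Fin (m + 2) → ℂ) → ℂ} (h : IsRootBranch k U r)
    {s : ℕ} (hs : s ≠ 0) :
    Set.EqOn (powDeriv r s) (partialD 0 fun x => r x ^ s / (s : ℂ)) U := by
  intro x hx
  have := h.partialD_zpow_div hU (s := s) (by exact_mod_cast hs) hx 0
  simp only [zpow_natCast, Int.cast_natCast] at this
  rw [this, powDeriv]

/-- The functions `ψ_ρ(α)` of the different roots do not all coincide. -/
theorem not_all_rootFun_eqOn (hm : 1 ≤ m) (hk : StrictMono k) (hk0 : k 0 = 0)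
    (hd : d = k (Fin.last (m + 1))) (hU : IsOpen U) (hρ : ∀ j, IsRootBranch k U (ρ j))
    (hdist : ∀ x ∈ U, Function.Injective fun j => ρ j x) {p : Fin (m + 2) → ℂ} (hp : p ∈ U)
    (hp1 : p 1 ≠ 0) (hpl : p (Fin.last (m + 1)) ≠ 0) {α : Fin 2 → ℤ} (hα : α ∉ semigroupI k)
    (h : ∀ i j, Set.EqOn (rootFun k (ρ i) α) (rootFun k (ρ j) α) U) : False := by
  have hdpos : 0 < d := by
    have : k 0 < k (Fin.last (m + 1)) := hk (Fin.last_pos)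
    omega
  -- Differentiating N times in x_d replaces α by β = (α_0 - N, α_1 - N d). For this N both
  -- coordinates are negative, so `rootFun` becomes an iterated ∂_0 of ρ^s/s with s = -β_1 > 0.
  obtain ⟨N, hN0, hN1⟩ : ∃ N : ℕ, α 0 < N ∧ α 1 < N := ⟨(α 0).toNat + (α 1).toNat + 1, by omega,
    by omega⟩
  have hdegN : ∀ N : ℕ, deg k (N • Pi.single (Fin.last (m + 1)) 1) =
      N • deg k (Pi.single (Fin.last (m + 1)) 1) := by
    intro N
    induction N with
    | zero => rw [zero_smul, zero_smul, deg_zero]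
    | succ N ih => rw [succ_nsmul, succ_nsmul, deg_add, ih]
  set β := α - deg k (N • Pi.single (Fin.last (m + 1)) 1) with hβ
  have hβ0 : β 0 = α 0 - N := by
    rw [hβ, hdegN, Pi.sub_apply, Pi.smul_apply, deg_single_zero]; simp
  have hβ1 : β 1 = α 1 - N * d := by
    rw [hβ, hdegN, Pi.sub_apply, Pi.smul_apply, deg_single_one, ← hd]; simp
  have hs1 : (N : ℤ) ≤ N * d := by
    have : (1 : ℤ) ≤ d := by exact_mod_cast hdpos
    nlinarith
  obtain ⟨s, hs⟩ : ∃ s : ℕ, -β 1 = s := ⟨(-β 1).toNat, by omega⟩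
  have hs0 : s ≠ 0 := by omega
  set r := (-β 0 - 1).toNat with hr
  have hfun : ∀ i, Set.EqOn (rootFun k (ρ i) β)
      ((partialD 0)^[r + 1] fun x => ρ i x ^ s / (s : ℂ)) U := by
    intro i
    rw [rootFun, if_neg (by omega), hs, Function.iterate_succ_apply]
    exact iterate_partialD_congr hU (powDeriv_eq_partialD hU (hρ i) hs0) 0 r
  have heq : ∀ i j, Set.EqOn (rootFun k (ρ i) β) (rootFun k (ρ j) β) U := fun i j =>
    ((hρ i).iterD_rootFun hU hk0 hα _).symm.trans
      ((iterD_congr hU (h i j) _).trans ((hρ j).iterD_rootFun hU hk0 hα _))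
  obtain ⟨ε, hε, hball⟩ := Metric.isOpen_iff.1 hU p hp
  have hline : ∀ z ∈ Metric.ball (0 : ℂ) ε, shiftZero p z ∈ U := by
    intro z hz
    refine hball ?_
    rw [mem_ball_zero_iff] at hz
    rw [mem_ball_iff_norm, shiftZero, add_sub_cancel_left, norm_smul, Pi.norm_single, norm_one,
      mul_one]
    exact hz
  have hsm : ∀ i, ContDiffOn ℂ ∞ (fun x => ρ i x ^ s / (s : ℂ)) U := fun i =>
    (((hρ i).smooth hU).pow s).div_const _
  let i₀ : Fin d := ⟨0, hdpos⟩
  have hdiff : ∀ j, ∃ R : ℂ[X], ∀ z ∈ Metric.ball (0 : ℂ) ε,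
      ρ i₀ (shiftZero p z) ^ s / (s : ℂ) - ρ j (shiftZero p z) ^ s / (s : ℂ) = R.eval z := by
    intro j
    refine exists_polynomial_of_iterate_partialD_eq_zero hU hε hline (r + 1)
      ((hsm i₀).sub (hsm j)) fun x hx => ?_
    have h1 := iterate_partialD_sub hU (hsm i₀) (hsm j) 0 (r + 1) hx
    refine h1.trans ?_
    rw [Pi.sub_apply, ← hfun i₀ hx, ← hfun j hx, heq i₀ j hx, sub_self]
  choose R hR using hdiff
  obtain ⟨P, hP⟩ := exists_polynomial_sum_pow_shiftZero hk hd hρ hdist hpl hline s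
  have hsC : (s : ℂ) ≠ 0 := by exact_mod_cast hs0
  have hdC : (d : ℂ) ≠ 0 := by exact_mod_cast hdpos.ne'
  -- Averaging over j: d ρ_{i₀}^s is the sum of the differences ρ_{i₀}^s - ρ_j^s = s R_j plus the
  -- power sum P.
  let Q : ℂ[X] := C (d : ℂ)⁻¹ * (C (s : ℂ) * ∑ j, R j + P)
  have hQ : ∀ z ∈ Metric.ball (0 : ℂ) ε, ρ i₀ (shiftZero p z) ^ s = Q.eval z := by
    intro z hz
    simp only [Q, eval_mul, eval_C, eval_add, eval_finsetSum, ← hP z hz]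
    have h1 : (s : ℂ) * ∑ j, (R j).eval z =
        d * ρ i₀ (shiftZero p z) ^ s - ∑ j, ρ j (shiftZero p z) ^ s := by
      rw [Finset.mul_sum]
      have : ∀ j, (s : ℂ) * (R j).eval z = ρ i₀ (shiftZero p z) ^ s - ρ j (shiftZero p z) ^ s := by
        intro j
        rw [← hR j z hz]; field_simp
      simp [this, Finset.sum_sub_distrib]
    rw [h1, sub_add_cancel, inv_mul_cancel_left₀ hdC]
  -- Shifting x_0 by z adds z to f, so f(p; ρ) + z = 0 along the line.
  let G : ℂ[X] := -sparsePoly k p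
  have hG : ∀ z ∈ Metric.ball (0 : ℂ) ε, G.eval (ρ i₀ (shiftZero p z)) = z := by
    intro z hz
    have h1 := (hρ i₀).root _ (hline z hz)
    simp only [shiftZero_apply, add_mul, Finset.sum_add_distrib, ite_mul, zero_mul,
      Finset.sum_ite_eq', Finset.mem_univ, if_true] at h1
    rw [hk0, pow_zero, mul_one] at h1
    simp only [G, eval_neg, sparsePoly_eval]
    linear_combination -h1
  -- The identity holds at every value of ρ_{i₀} on the line; there are infinitely many, since G
  -- recovers z from ρ_{i₀}.
  have hpoly : (X ^ s : ℂ[X]) = Q.comp G := by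
    refine eq_of_infinite_eval_eq _ _ (Set.Infinite.mono (s :=
      (fun z => ρ i₀ (shiftZero p z)) '' Metric.ball (0 : ℂ) ε) ?_ ?_)
    · rintro _ ⟨z, hz, rfl⟩
      change eval _ _ = eval _ _
      rw [eval_pow, eval_X, eval_comp, hG z hz, hQ z hz]
    · refine Set.Infinite.image (fun z hz w hw h => ?_)
        (infinite_of_mem_nhds (0 : ℂ) (Metric.ball_mem_nhds _ hε))
      rw [← hG z hz, ← hG w hw]
      exact congrArg (fun t => G.eval t) h
  obtain ⟨a, ha0, ha⟩ := exists_ne_zero_sparsePoly_eval_eq hk hm hk0 hp1 hpl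
  have h1 := congrArg (eval a) hpoly
  have h2 := congrArg (eval 0) hpoly
  simp only [eval_pow, eval_X, eval_comp, G, eval_neg, ha] at h1 h2
  rw [← h2, zero_pow hs0] at h1
  exact ha0 (pow_eq_zero_iff hs0 |>.1 h1)

end NotAllEqual

/-! ### Assembling the theorem -/

section Conclusion

variable {m d : ℕ} {k : Fin (m + 2) → ℕ} {U : Set (Fin (m + 2) → ℂ)}
  {ρ : Fin d → (Fin (m + 2) → ℂ) → ℂ}

/-- Roots are nonzero because x_0 ≠ 0, and simple because d distinct roots exhaust a polynomial of
degree d. -/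
theorem isRootBranch_of_isRoot (hk : StrictMono k) (hk0 : k 0 = 0)
    (hd : d = k (Fin.last (m + 1))) (hUs : U ⊆ (singularLocus k)ᶜ)
    (hρhol : ∀ j, DifferentiableOn ℂ (ρ j) U)
    (hρroot : ∀ j, ∀ x ∈ U, (genPoly k x).IsRoot (ρ j x))
    (hρdist : ∀ x ∈ U, Function.Injective fun j => ρ j x) (j : Fin d) :
    IsRootBranch k U (ρ j) := by
  have hroot : ∀ x ∈ U, ∑ l, x l * ρ j x ^ k l = 0 := fun x hx =>
    (sparsePoly_eval k x (ρ j x)).symm.trans (hρroot j x hx)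
  refine ⟨hρhol j, fun x hx h0 => ?_, hroot, fun x hx h0 => ?_⟩
  · have h1 := hroot x hx
    rw [h0, Finset.sum_eq_single 0] at h1
    · rw [hk0, pow_zero, mul_one] at h1
      exact hUs hx (Or.inl h1)
    · intro l _ hl
      have : k 0 < k l := hk (Fin.pos_of_ne_zero hl)
      rw [zero_pow (by omega), mul_zero]
    · simp
  · have hlast : x (Fin.last (m + 1)) ≠ 0 := fun h => hUs hx (Or.inr (Or.inl h))
    have hdeg : (genPoly k x).natDegree = d := (sparsePoly_natDegree hk hlast).trans hd.symm
    have hne : genPoly k x ≠ 0 := by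
      intro h
      have := sparsePoly_coeff hk x (Fin.last (m + 1))
      rw [show sparsePoly k x = genPoly k x from rfl, h, coeff_zero] at this
      exact hlast this.symm
    have hder : (derivative (genPoly k x)).IsRoot (ρ j x) := by
      rw [IsRoot, ← h0, genPoly, derivAtRoot]
      simp [eval_finsetSum, derivative_X_pow]
    have h1 := (one_lt_rootMultiplicity_iff_isRoot hne).2 ⟨hρroot j x hx, hder⟩
    have hnodup : (genPoly k x).roots.Nodup := by
      rw [roots_eq_map_of_injective hne hdeg (hρdist x hx) fun i => hρroot i x hx]
      exact Multiset.Nodup.map (hρdist x hx) Finset.univ.nodup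
    rw [← count_roots] at h1
    exact absurd (Multiset.nodup_iff_count_le_one.1 hnodup (ρ j x)) (by omega)

/-- The coefficients of a linear relation between the functions `ψ_ρ(α)` are all equal. -/
theorem coeff_eq_of_rootFun_relation (hm : 1 ≤ m) (hk : StrictMono k) (hk0 : k 0 = 0)
    (hgcd : Finset.univ.gcd k = 1) (hd : d = k (Fin.last (m + 1))) (hU : IsOpen U)
    (hne : U.Nonempty) (hlast : ∀ x ∈ U, x (Fin.last (m + 1)) ≠ 0)
    (hρ : ∀ j, IsRootBranch k U (ρ j)) (hdist : ∀ x ∈ U, Function.Injective fun j => ρ j x)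
    {α : Fin 2 → ℤ} (hα : α ∉ semigroupI k) {c : Fin d → ℂ}
    (hrel : ∀ x ∈ U, ∑ j, c j * rootFun k (ρ j) α x = 0) (a b : Fin d) : c a = c b := by
  by_contra hab
  -- An open set does not lie in x_1 = 0, as ∂x_1/∂x_1 = 1. A ball around p then provides the
  -- convexity needed for the domain property.
  obtain ⟨p, hp, hp1⟩ : ∃ p ∈ U, p 1 ≠ 0 := by
    by_contra! hcon
    obtain ⟨y, hy⟩ := hne
    have h1 := partialD_congr hU (g := fun x => x 1) (h := fun _ => 0) hcon 1 hy
    rw [partialD_coord, partialD_const] at h1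
    simp at h1
  obtain ⟨ε, hε, hball⟩ := Metric.isOpen_iff.1 hU p hp
  have hρB := fun j => (hρ j).mono hball
  exact not_all_rootFun_eqOn hm hk hk0 hd Metric.isOpen_ball hρB (fun x hx => hdist x (hball hx))
    (Metric.mem_ball_self hε) hp1 (hlast p hp) hα
    ((IsRationalFamilyOn.rootFun Metric.isOpen_ball hρB α).eqOn_of_relation hk hk0 hgcd hd
      Metric.isOpen_ball (convex_ball p ε) ⟨p, Metric.mem_ball_self hε⟩ hρB
      (fun x hx => hdist x (hball hx)) c (fun x hx => hrel x (hball hx)) hab)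

/-- If all linear relations between `d` vectors have constant coefficients, then the vectors span a
space of dimension at least `d - 1`, and they are dependent if and only if their sum is zero. -/
theorem finrank_span_and_linearIndependent_iff {V : Type*} [AddCommGroup V] [Module ℂ V]
    (hd : 0 < d) {v : Fin d → V}
    (h : ∀ c : Fin d → ℂ, ∑ j, c j • v j = 0 → ∀ a b, c a = c b) :
    d - 1 ≤ Module.finrank ℂ (Submodule.span ℂ (Set.range v)) ∧
      (¬ LinearIndependent ℂ v ↔ ∑ j, v j = 0) := by
  -- The space of relations lies in the line of constant vectors; rank-nullity then gives the bound.
  have hker : LinearMap.ker (Fintype.linearCombination ℂ v) ≤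
      Submodule.span ℂ {fun _ : Fin d => (1 : ℂ)} := by
    intro c hc
    rw [LinearMap.mem_ker, Fintype.linearCombination_apply] at hc
    rw [Submodule.mem_span_singleton]
    exact ⟨c ⟨0, hd⟩, funext fun j => by simpa using h c hc _ j⟩
  constructor
  · have h1 := (Fintype.linearCombination ℂ v).finrank_range_add_finrank_ker
    rw [Fintype.range_linearCombination, Module.finrank_fintype_fun_eq_card, Fintype.card_fin] at h1
    have h2 := (Submodule.finrank_mono hker).trans
      (finrank_span_le_card ({fun _ => 1} : Set (Fin d → ℂ)))
    simp only [Set.toFinset_singleton, Finset.card_singleton] at h2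
    omega
  · rw [Fintype.not_linearIndependent_iff]
    constructor
    · rintro ⟨c, hc, i, hi⟩
      have h1 : ∑ j, c j • v j = c i • ∑ j, v j := by
        rw [Finset.smul_sum]
        exact Finset.sum_congr rfl fun j _ => by rw [h c hc j i]
      rw [h1] at hc
      exact (smul_eq_zero.1 hc).resolve_left hi
    · intro hs
      exact ⟨fun _ => 1, by simpa using hs, ⟨0, hd⟩, one_ne_zero⟩

end Conclusion

end

end MonomialCurve

theorem theorem2p4 (m : ℕ) (hm : 1 ≤ m) (k : Fin (m + 2) → ℕ) (hk : StrictMono k)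
    (hk0 : k 0 = 0) (hgcd : Finset.univ.gcd k = 1)
    (d : ℕ) (hd : d = k (Fin.last (m + 1)))
    (U : Set (Fin (m + 2) → ℂ)) (hUo : IsOpen U) (hUsc : IsSimplyConnected U)
    (hUs : U ⊆ (MonomialCurve.singularLocus k)ᶜ)
    (ρ : Fin d → (Fin (m + 2) → ℂ) → ℂ)
    (hρhol : ∀ j, DifferentiableOn ℂ (ρ j) U)
    (hρroot : ∀ j, ∀ x ∈ U, (MonomialCurve.genPoly k x).IsRoot (ρ j x))
    (hρdist : ∀ x ∈ U, Function.Injective fun j => ρ j x)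
    (α : Fin 2 → ℤ) (hα : α ∉ MonomialCurve.semigroupI k)
    (u : Fin (m + 2) → ℕ) (hu : MonomialCurve.IsAdmissible k α u) :
    (∀ j, MonomialCurve.IsHypergeometricOn k α U (MonomialCurve.psi k (ρ j) α u)) ∧
    d - 1 ≤ Module.finrank ℂ
      (Submodule.span ℂ (Set.range fun j => U.domRestrict (MonomialCurve.psi k (ρ j) α u))) ∧
    (¬ LinearIndependent ℂ (fun j => U.domRestrict (MonomialCurve.psi k (ρ j) α u)) ↔
      ∀ x ∈ U, ∑ j, MonomialCurve.psi k (ρ j) α u x = 0) := by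
  have hρ := MonomialCurve.isRootBranch_of_isRoot hk hk0 hd hUs hρhol hρroot hρdist
  have hdpos : 0 < d := by
    have : k 0 < k (Fin.last (m + 1)) := hk Fin.last_pos
    omega
  have hrel : ∀ c : Fin d → ℂ,
      ∑ j, c j • U.domRestrict (MonomialCurve.psi k (ρ j) α u) = 0 → ∀ a b, c a = c b := by
    intro c hc
    refine MonomialCurve.coeff_eq_of_rootFun_relation hm hk hk0 hgcd hd hUo hUsc.nonempty
      (fun x hx h => hUs hx (Or.inr (Or.inl h))) hρ hρdist hα fun x hx => ?_
    have h1 := congrFun hc ⟨x, hx⟩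
    simp only [Finset.sum_apply, Pi.smul_apply, smul_eq_mul, Pi.zero_apply] at h1
    rw [← h1]
    exact Finset.sum_congr rfl fun j _ => by
      rw [← (hρ j).psi_eqOn_rootFun hUo hk hk0 hu hx]; rfl
  obtain ⟨h1, h2⟩ := MonomialCurve.finrank_span_and_linearIndependent_iff hdpos hrel
  refine ⟨fun j => (hρ j).psi_isHypergeometricOn hUo hk hk0 hα hu, h1, h2.trans ?_⟩
  constructor
  · intro h x hx
    have := congrFun h ⟨x, hx⟩
    simpa using this
  · intro h
    funext x
    simpa using h x x.2
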